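/- Let $k\ge 3$ and $0\le\alpha<1$. A $k$-uniform hypergraph $H$ has a finite vertex set $V(H)$ and a set $E(H)$ of $k$-element subsets of $V(H)$; the degree $\deg_H(x)$ of a vertex is the number of edges containing it, and a vertex is pendant if its degree is $1$. Let $\mathcal A_\alpha(H)=\alpha\,\mathcal D(H)+(1-\alpha)\,\mathcal A(H)$, where $\mathcal A(H)$ is the tensor of order $k$ indexed by $V(H)$ whose entry at $(i_1,\dots,i_k)$ is $\frac1{(k-1)!}$ if $\{i_1,\dots,i_k\}\in E(H)$ and $0$ otherwise, and $\mathcal D(H)$ is the diagonal tensor of order $k$ with the vertex degrees on the diagonal. A number $\lambda\in\mathbb C$ is an eigenvalue of a tensor $\mathcal T$ of order $k$ if there is a nonzero complex vector $x$ with $\sum_{i_2,\dots,i_k} t_{i\,i_2\cdots i_k}x_{i_2}\cdots x_{i_k}=\lambda x_i^{k-1}$ for all $i$. The $\alpha$-spectral radius $\rho_\alpha(H)$ is the largest modulus of an eigenvalue of $\mathcal A_\alpha(H)$. A loose path $w_0e_1w_1e_2\cdots e_sw_s$ of length $s\ge 0$ consists of distinct edges $e_1,\dots,e_s$ with $|e_i\cap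 e_j|=1$ if $|i-j|=1$ and $e_i\cap e_j=\varnothing$ if $|i-j|>1$, and of vertices $w_{i-1}\ne w_i$ with $w_{i-1},w_i\in e_i$ for $1\le i\le s$ (for $s=0$ it is a single vertex). It is an internal path of $H$ if $\deg_H(w_0)\ge 3$, $\deg_H(w_s)\ge 3$, and each of its vertices other than $w_0,w_s$ has in $H$ the same degree as in the path. For vertices $u,v$ (possibly equal) of a $k$-uniform hypergraph $G$, let $G_{u,v}(p,q)$ be the hypergraph obtained from $G$ by attaching a $k$-uniform loose path of length $p$ by an end vertex to $u$ and another one, of length $q$, by an end vertex to $v$, where all vertices of the attached paths other than $u,v$ are new. **Theorem.** Let $G$ be a connected $k$-uniform hypergraph, let $u,v$ be non-pendant vertices of $G$, and let $p\ge q\ge 1$ and $s\ge 0$ be integers. Suppose that $G_{u,v}(p,q)$ has an internal path of length $s$ with ends $v$ and $u$ (so $u=v$ if $s=0$), and that $p-q+1\ge s$. Then $$\rho_\alpha(G_{u,v}(p+1,q-1))<\rho_\alpha(G_{u,v}(p,q)).$$ -/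

import Mathlib

/-! ### Eigenvalues of tensors -/

/-- The vector `A x^m` attached to a real tensor `A` of order `m + 1` and a complex vector `x`:
its `i`-th entry is the sum of `a_{i f₁ … f_m} x_{f₁} ⋯ x_{f_m}` over all `f₁, …, f_m`. -/
noncomputable def tensorApply {ι : Type*} [Fintype ι] {m : ℕ} (A : (Fin (m + 1) → ι) → ℝ)
    (x : ι → ℂ) (i : ι) : ℂ :=
  ∑ f : Fin m → ι, (A (Fin.cons i f) : ℂ) * ∏ j, x (f j)

/-- `μ` is an eigenvalue of the tensor `A` of order `m + 1`: there is a nonzero complex vector `x`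
with `A x^m = μ x^{[m]}`, where `x^{[m]}` is the entrywise `m`-th power. -/
def IsTensorEigenvalue {ι : Type*} [Fintype ι] {m : ℕ} (A : (Fin (m + 1) → ι) → ℝ)
    (μ : ℂ) : Prop :=
  ∃ x : ι → ℂ, x ≠ 0 ∧ ∀ i, tensorApply A x i = μ * x i ^ m

/-- The spectral radius of a tensor: the largest modulus of its eigenvalues. -/
noncomputable def tensorSpectralRadius {ι : Type*} [Fintype ι] {m : ℕ}
    (A : (Fin (m + 1) → ι) → ℝ) : ℝ :=
  sSup {r : ℝ | ∃ μ : ℂ, IsTensorEigenvalue A μ ∧ r = ‖μ‖}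

namespace Hypergraph

/-! ### Basic notions for hypergraphs -/

/-- Every edge has exactly `k` vertices. -/
def IsUniform {V : Type*} (H : Hypergraph V) (k : ℕ) : Prop :=
  ∀ e ∈ H.edgeSet, e.ncard = k

/-- Nonempty, and any two vertices are joined by a walk. -/
def IsConnected {V : Type*} (H : Hypergraph V) : Prop :=
  H.vertexSet.Nonempty ∧
    ∀ x ∈ H.vertexSet, ∀ y ∈ H.vertexSet, Relation.ReflTransGen H.Adj x y

/-- The degree of a vertex: the number of edges containing it. -/
noncomputable def degree {V : Type*} (H : Hypergraph V) (x : V) : ℕ :=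
  {e | e ∈ H.edgeSet ∧ x ∈ e}.ncard

/-- A pendant vertex is a vertex of degree one. -/
def IsPendantVertex {V : Type*} (H : Hypergraph V) (x : V) : Prop :=
  x ∈ H.vertexSet ∧ H.degree x = 1

/-! ### The `α`-spectral radius -/

open Classical in
/-- The adjacency tensor, of order `m + 1`, of an `(m + 1)`-uniform hypergraph. -/
noncomputable def adjacencyTensor {V : Type*} (H : Hypergraph V) (m : ℕ)
    (f : Fin (m + 1) → H.vertexSet) : ℝ :=
  if Set.range (fun j => (f j : V)) ∈ H.edgeSet then 1 / (m.factorial : ℝ) else 0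

open Classical in
/-- The degree tensor of order `m + 1`: diagonal, with the vertex degrees on the diagonal. -/
noncomputable def degreeTensor {V : Type*} (H : Hypergraph V) (m : ℕ)
    (f : Fin (m + 1) → H.vertexSet) : ℝ :=
  if ∀ j, f j = f 0 then (H.degree (f 0) : ℝ) else 0

/-- The tensor `𝒜_α = α 𝒟 + (1 - α) 𝒜` of order `m + 1`. -/
noncomputable def alphaTensor {V : Type*} (H : Hypergraph V) (m : ℕ) (α : ℝ)
    (f : Fin (m + 1) → H.vertexSet) : ℝ :=
  α * H.degreeTensor m f + (1 - α) * H.adjacencyTensor m f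

open Classical in
/-- The `α`-spectral radius `ρ_α(H)` of a `k`-uniform hypergraph `H`, `k ≥ 1`: the spectral radius
of its tensor `𝒜_α`, which has order `k = (k - 1) + 1`. -/
noncomputable def alphaSpectralRadius {V : Type*} [Fintype V] (H : Hypergraph V) (k : ℕ)
    (α : ℝ) : ℝ :=
  tensorSpectralRadius (H.alphaTensor (k - 1) α)

/-! ### Loose paths and internal paths -/

/-- `w₀ e₁ w₁ e₂ … e_d w_d` is a loose path of length `d` in `H`. The edge `e_{i+1}` is `e i`.
A loose path of length `0` is a single vertex. -/
structure IsLoosePath {V : Type*} (H : Hypergraph V) (d : ℕ) (w : Fin (d + 1) → V)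
    (e : Fin d → Set V) : Prop where
  vertex_mem : ∀ i, w i ∈ H.vertexSet
  edge_mem : ∀ i, e i ∈ H.edgeSet
  edge_injective : Function.Injective e
  inter_consecutive : ∀ i j : Fin d, i.val + 1 = j.val → (e i ∩ e j).ncard = 1
  inter_far : ∀ i j : Fin d, i.val + 1 < j.val → e i ∩ e j = ∅
  left_mem : ∀ i : Fin d, w i.castSucc ∈ e i
  right_mem : ∀ i : Fin d, w i.succ ∈ e i
  left_ne_right : ∀ i : Fin d, w i.castSucc ≠ w i.succ

/-- The loose path `w₀ e₁ w₁ … e_d w_d` is an internal path of `H`: its two ends have degree at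
least `3` in `H`, and every other vertex of the path has the same degree in `H` as in the path. -/
structure IsInternalPath {V : Type*} (H : Hypergraph V) (d : ℕ) (w : Fin (d + 1) → V)
    (e : Fin d → Set V) : Prop where
  isLoosePath : H.IsLoosePath d w e
  degree_first : 3 ≤ H.degree (w 0)
  degree_last : 3 ≤ H.degree (w (Fin.last d))
  degree_inner : ∀ i : Fin d, ∀ x ∈ e i, x ≠ w 0 → x ≠ w (Fin.last d) →
    H.degree x = {j : Fin d | x ∈ e j}.ncard

/-- There is an internal path of length `d` from `x` to `y` in `H`. -/
def HasInternalPath {V : Type*} (H : Hypergraph V) (x y : V) (d : ℕ) : Prop :=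
  ∃ (w : Fin (d + 1) → V) (e : Fin d → Set V),
    H.IsInternalPath d w e ∧ w 0 = x ∧ w (Fin.last d) = y

/-! ### Attaching pendant paths -/

/-- The `i`-th edge (counted from `0`) of a pendant `k`-uniform loose path of length `p` attached
at `u`. It consists of its `k - 1` new vertices `(i, j)` and of the vertex where it is attached:
`u` if `i = 0`, and the vertex `(i - 1, 0)` of the preceding edge otherwise. -/
def pendantPathEdge {V : Type*} (k : ℕ) (u : V) (p : ℕ) (i : Fin p) :
    Set (V ⊕ (Fin p × Fin (k - 1))) :=
  {x | (i.val = 0 ∧ x = Sum.inl u) ∨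
    (∃ a : Fin p, ∃ j : Fin (k - 1), a.val + 1 = i.val ∧ j.val = 0 ∧ x = Sum.inr (a, j)) ∨
    (∃ j : Fin (k - 1), x = Sum.inr (i, j))}

/-- The hypergraph obtained from the `k`-uniform hypergraph `G`, `k ≥ 2`, by attaching a pendant
loose path of length `p` at the vertex `u` (so `insert u G.vertexSet` is `G.vertexSet`). -/
def attachPath {V : Type*} (G : Hypergraph V) (k : ℕ) (u : V) (p : ℕ) :
    Hypergraph (V ⊕ (Fin p × Fin (k - 1))) where
  vertexSet := Sum.inl '' insert u G.vertexSet ∪ Set.range Sum.inr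
  edgeSet := (fun e : Set V => Sum.inl '' e) '' G.edgeSet ∪ Set.range (pendantPathEdge k u p)
  subset_vertexSet_of_mem_edgeSet' := by
    rintro e (⟨e, he, rfl⟩ | ⟨i, rfl⟩)
    · rintro _ ⟨x, hx, rfl⟩
      exact Or.inl ⟨x, Or.inr (G.subset_vertexSet_of_mem_edgeSet' he hx), rfl⟩
    · rintro x (⟨-, rfl⟩ | ⟨a, j, -, -, rfl⟩ | ⟨j, rfl⟩)
      · exact Or.inl ⟨u, Or.inl rfl, rfl⟩
      · exact Or.inr ⟨_, rfl⟩
      · exact Or.inr ⟨_, rfl⟩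

/-- `G_{u,v}(p, q)`: pendant loose paths of lengths `p` and `q` are attached to `G` at the vertices
`u` and `v` (which may coincide). The vertex `x` of `G` becomes `Sum.inl (Sum.inl x)`. -/
def attachTwoPaths {V : Type*} (G : Hypergraph V) (k : ℕ) (u v : V) (p q : ℕ) :
    Hypergraph ((V ⊕ (Fin p × Fin (k - 1))) ⊕ (Fin q × Fin (k - 1))) :=
  (G.attachPath k u p).attachPath k (Sum.inl v) q

end Hypergraph

/-! The proof is variational. For a connected hypergraph, `ρ_α` is the maximum of the form `x · 𝒜_α
x^{k-1}` over nonnegative `x` with `∑ x_i^k = 1`, attained at a positive vector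
(`exists_perron_vector`). It is therefore enough to turn the Perron vector of `G_{u,v}(p+1,q-1)`
into a better trial vector for `G_{u,v}(p,q)`.

The internal path lies in `G`. Together with the two pendant paths it forms, in both hypergraphs, a
loose path of length `L = p+q+s` with joints `0, …, L`. The remaining edges form a core that sees
this path only at `v` and `u`. These are the joints `q-1` and `q-1+s` in `G_{u,v}(p+1,q-1)`. In
`G_{u,v}(p,q)`, read backwards, they are `p+s` and `p`. The reflection `r ↦ L-1-r` exchanges the two
pairs, and `s ≤ p-q+1` says that `q-1+s` is not beyond the centre of the reflection.

Let `z` be the Perron values at the joints and `η` those at the degree-one vertices of the path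
edges (constant on each edge, up to the choice of joint at a pendant end). If `z_r < z_{L-1-r}` for
all `r ≤ q-1+s`, the same vector on the path is already better, since the core form is increasing.
Otherwise take the least `t` violating this and reflect only the stretch from `t` to `L-1-t`. At
most two path edges change their contribution, and the change is a product of differences with known
signs, possibly after also exchanging the `η`-values of these two edges.

Strictness comes from the core if `q-1 < t`. If `t ≤ q-1` the gain may vanish. Raising `z_t` by `δ`
then costs nothing to first order, by maximality of the Perron vector, but makes the gain at least
linear in `δ` (`lt_of_slope`). `lt_of_pathForm_le` carries out this comparison; `IsPathVector`
translates between vectors on the hypergraphs and pairs `(z, η)`. -/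

namespace Hypergraph

/-! ### The form of a uniform family of finite sets -/

section Family

variable {ι : Type*}

/-- The form attached to an `(m + 1)`-uniform family of finite sets. -/
noncomputable def familyForm (m : ℕ) (α : ℝ) (E : Finset (Finset ι)) (x : ι → ℝ) : ℝ :=
  ∑ e ∈ E, (α * ∑ i ∈ e, x i ^ (m + 1) + (1 - α) * (m + 1) * ∏ i ∈ e, x i)

lemma familyForm_smul {m : ℕ} {α : ℝ} {E : Finset (Finset ι)} (hE : ∀ e ∈ E, e.card = m + 1)
    (c : ℝ) (x : ι → ℝ) :
    familyForm m α E (fun i => c * x i) = c ^ (m + 1) * familyForm m α E x := by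
  unfold familyForm
  rw [Finset.mul_sum]
  refine Finset.sum_congr rfl fun e he => ?_
  simp only [mul_pow, Finset.prod_mul_distrib, Finset.prod_const, hE e he, ← Finset.mul_sum]
  ring

variable [DecidableEq ι]

lemma familyForm_update {m : ℕ} {α : ℝ} (E : Finset (Finset ι)) (x : ι → ℝ) (i : ι) (t : ℝ) :
    familyForm m α E (Function.update x i t) = familyForm m α E x +
      ∑ e ∈ E with i ∈ e, (α * (t ^ (m + 1) - x i ^ (m + 1)) +
        (1 - α) * (m + 1) * ((t - x i) * ∏ j ∈ e.erase i, x j)) := by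
  unfold familyForm
  rw [Finset.sum_filter, ← Finset.sum_add_distrib]
  refine Finset.sum_congr rfl fun e _ => ?_
  split_ifs with h
  · rw [← Finset.add_sum_erase e _ h, ← Finset.add_sum_erase e (fun j => x j ^ (m + 1)) h,
      ← Finset.mul_prod_erase e _ h, ← Finset.mul_prod_erase e x h,
      Finset.sum_congr rfl (g := fun j => x j ^ (m + 1)) fun j hj => by
        rw [Function.update_of_ne (Finset.ne_of_mem_erase hj)],
      Finset.prod_congr rfl (g := x) fun j hj => by
        rw [Function.update_of_ne (Finset.ne_of_mem_erase hj)]]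
    simp only [Function.update_self]
    ring
  · have hne : ∀ j ∈ e, j ≠ i := fun j hj hji => h (hji ▸ hj)
    rw [Finset.sum_congr rfl (g := fun j => x j ^ (m + 1)) fun j hj => by
        rw [Function.update_of_ne (hne j hj)],
      Finset.prod_congr rfl (g := x) fun j hj => by rw [Function.update_of_ne (hne j hj)]]
    ring

/-! ### Maximizers of the form and eigenvalues -/

variable [Fintype ι]

/-- The nonnegative part of the unit sphere is compact, and homogeneity of degree `m + 1` carries
the bound from there to every nonnegative vector. -/
lemma exists_familyForm_maximizer [Nonempty ι] {m : ℕ} {α : ℝ} {E : Finset (Finset ι)}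
    (hE : ∀ e ∈ E, e.card = m + 1) :
    ∃ (x : ι → ℝ) (M : ℝ), (∀ i, 0 ≤ x i) ∧ (∃ i, 0 < x i) ∧
      familyForm m α E x = M * ∑ i, x i ^ (m + 1) ∧
      ∀ y : ι → ℝ, (∀ i, 0 ≤ y i) → familyForm m α E y ≤ M * ∑ i, y i ^ (m + 1) := by
  classical
  set K : Set (ι → ℝ) := {x | (∀ i, 0 ≤ x i) ∧ ∑ i, x i ^ (m + 1) = 1} with hK
  have hKclosed : IsClosed K := by
    have h1 : IsClosed {x : ι → ℝ | ∀ i, 0 ≤ x i} := by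
      simp only [Set.ofPred_forall]
      exact isClosed_iInter fun i => isClosed_le continuous_const (continuous_apply i)
    exact h1.inter (isClosed_eq (by fun_prop) continuous_const)
  have hKsub : K ⊆ Set.Icc 0 1 := by
    rintro x ⟨hx0, hx1⟩
    refine ⟨hx0, fun i => ?_⟩
    have h : x i ^ (m + 1) ≤ 1 := by
      rw [← hx1]
      exact Finset.single_le_sum (f := fun i => x i ^ (m + 1))
        (fun j _ => pow_nonneg (hx0 j) _) (Finset.mem_univ i)
    exact (pow_le_one_iff_of_nonneg (hx0 i) (by omega)).1 h
  have hKcomp : IsCompact K := isCompact_Icc.of_isClosed_subset hKclosed hKsub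
  obtain ⟨i₀⟩ := ‹Nonempty ι›
  have hKne : K.Nonempty := by
    refine ⟨Pi.single i₀ 1, fun i => ?_, ?_⟩
    · by_cases h : i = i₀
      · subst h; simp
      · simp [h]
    · rw [Finset.sum_eq_single i₀] <;> simp +contextual
  obtain ⟨x, hxK, hmax⟩ := hKcomp.exists_isMaxOn hKne
    (f := familyForm m α E) (by unfold familyForm; fun_prop)
  refine ⟨x, familyForm m α E x, hxK.1, ?_, by rw [hxK.2, mul_one], fun y hy => ?_⟩
  · by_contra! h
    have : ∀ i, x i = 0 := fun i => le_antisymm (h i) (hxK.1 i)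
    simpa [this] using hxK.2
  · rcases (Finset.sum_nonneg fun i _ => pow_nonneg (hy i) (m + 1) :
      0 ≤ ∑ i, y i ^ (m + 1)).eq_or_lt with h | h
    · have hy0 : ∀ i, y i = 0 := by
        intro i
        have := (Finset.sum_eq_zero_iff_of_nonneg fun i _ => pow_nonneg (hy i) (m + 1)).1 h.symm i
          (Finset.mem_univ i)
        exact pow_eq_zero_iff (by omega) |>.1 this
      have : familyForm m α E y = 0 := by
        have h2 := familyForm_smul (α := α) hE 0 y
        have h3 : (fun i => 0 * y i) = y := by ext i; simp [hy0 i]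
        rw [h3] at h2
        simpa using h2
      rw [this, ← h, mul_zero]
    · set S := ∑ i, y i ^ (m + 1) with hS
      set c : ℝ := (S ^ ((m + 1 : ℕ) : ℝ)⁻¹)⁻¹ with hc
      have hcS : c ^ (m + 1) * S = 1 := by
        rw [hc, inv_pow, Real.rpow_inv_natCast_pow h.le (by omega), inv_mul_cancel₀ h.ne']
      have hc0 : 0 ≤ c := by positivity
      have hmem : (fun i => c * y i) ∈ K := by
        refine ⟨fun i => mul_nonneg hc0 (hy i), ?_⟩
        simp only [mul_pow, ← Finset.mul_sum]
        exact hcS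
      have h4 : familyForm m α E (fun i => c * y i) ≤ familyForm m α E x := hmax hmem
      rw [familyForm_smul hE] at h4
      calc familyForm m α E y = (c ^ (m + 1) * familyForm m α E y) * S := by
            linear_combination (-familyForm m α E y) * hcS
        _ ≤ familyForm m α E x * S := mul_le_mul_of_nonneg_right h4 h.le

/-- If the support were not closed under edges, some edge would contain both zeros and positive
entries of `x`. Raising its `n ≤ m` zeros to `ε` gains at least a multiple of `ε ^ n` in the form
but adds only `n * ε ^ (m + 1)` to the power sum, which contradicts maximality for small `ε`. -/
lemma familyForm_maximizer_pos {m : ℕ} {α : ℝ} (hα0 : 0 ≤ α) (hα1 : α < 1)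
    {E : Finset (Finset ι)} (hE : ∀ e ∈ E, e.card = m + 1)
    (hconn : ∀ S : Set ι, S.Nonempty → (∀ e ∈ E, (∃ i ∈ e, i ∈ S) → ∀ i ∈ e, i ∈ S) → ∀ i, i ∈ S)
    {x : ι → ℝ} {M : ℝ} (hx0 : ∀ i, 0 ≤ x i) (hx1 : ∃ i, 0 < x i)
    (hxM : familyForm m α E x = M * ∑ i, x i ^ (m + 1))
    (hmax : ∀ y : ι → ℝ, (∀ i, 0 ≤ y i) → familyForm m α E y ≤ M * ∑ i, y i ^ (m + 1)) :
    ∀ i, 0 < x i := by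
  refine hconn {i | 0 < x i} hx1 ?_
  rintro e he ⟨i₀, hi₀, hi₀x⟩ j₀ hj₀
  by_contra hj
  have hj0 : x j₀ = 0 := le_antisymm (not_lt.1 hj) (hx0 j₀)
  set Z := e.filter fun i => x i = 0 with hZ
  set n := Z.card with hn
  have hn1 : 1 ≤ n := Finset.card_pos.2 ⟨j₀, by simp [hZ, hj₀, hj0]⟩
  have hnm : n ≤ m := by
    have : Z ⊂ e := by
      refine Finset.filter_ssubset.2 ⟨i₀, hi₀, hi₀x.ne'⟩
    have := Finset.card_lt_card this
    rw [hE e he] at this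
    omega
  set c := ∏ i ∈ e.filter fun i => ¬ x i = 0, x i with hc
  have hcpos : 0 < c := Finset.prod_pos fun i hi =>
    lt_of_le_of_ne (hx0 i) (Ne.symm (Finset.mem_filter.1 hi).2)
  have key : ∀ ε : ℝ, 0 < ε → ε ≤ 1 → (1 - α) * (m + 1) * c ≤ M * n * ε := by
    intro ε hε hε1
    set y : ι → ℝ := fun i => if i ∈ Z then ε else x i with hy
    have hy0 : ∀ i, 0 ≤ y i := fun i => by
      simp only [hy]; split_ifs <;> [exact hε.le; exact hx0 i]
    have hxy : ∀ i, x i ≤ y i := fun i => by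
      simp only [hy]; split_ifs with h
      · rw [(Finset.mem_filter.1 h).2]; exact hε.le
      · exact le_rfl
    have hprod : ∏ i ∈ e, y i = ε ^ n * c := by
      rw [← Finset.prod_filter_mul_prod_filter_not e (fun i => x i = 0)]
      congr 1
      · rw [Finset.prod_congr rfl (g := fun _ => ε) fun i hi => if_pos hi]
        simp [hn, hZ]
      · refine Finset.prod_congr rfl fun i hi => ?_
        have := (Finset.mem_filter.1 hi).2
        simp [hy, hZ, this]
    have hprodx : ∏ i ∈ e, x i = 0 := Finset.prod_eq_zero hj₀ hj0
    have hterm : ∀ f ∈ E, α * ∑ i ∈ f, x i ^ (m + 1) + (1 - α) * (m + 1) * ∏ i ∈ f, x i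
        ≤ α * ∑ i ∈ f, y i ^ (m + 1) + (1 - α) * (m + 1) * ∏ i ∈ f, y i := by
      intro f _
      have h1 : ∑ i ∈ f, x i ^ (m + 1) ≤ ∑ i ∈ f, y i ^ (m + 1) :=
        Finset.sum_le_sum fun i _ => pow_le_pow_left₀ (hx0 i) (hxy i) _
      have h2 : ∏ i ∈ f, x i ≤ ∏ i ∈ f, y i :=
        Finset.prod_le_prod (fun i _ => hx0 i) fun i _ => hxy i
      have h3 : 0 ≤ (1 - α) * (m + 1) := mul_nonneg (by linarith) (by positivity)
      exact add_le_add (mul_le_mul_of_nonneg_left h1 hα0) (mul_le_mul_of_nonneg_left h2 h3)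
    have hF : familyForm m α E x + (1 - α) * (m + 1) * (ε ^ n * c) ≤ familyForm m α E y := by
      unfold familyForm
      rw [← Finset.add_sum_erase _ _ he, ← Finset.add_sum_erase E (fun f =>
        α * ∑ i ∈ f, y i ^ (m + 1) + (1 - α) * (m + 1) * ∏ i ∈ f, y i) he]
      have h1 := Finset.sum_le_sum fun f (hf : f ∈ E.erase e) =>
        hterm f (Finset.mem_of_mem_erase hf)
      have h2 : ∑ i ∈ e, x i ^ (m + 1) ≤ ∑ i ∈ e, y i ^ (m + 1) :=
        Finset.sum_le_sum fun i _ => pow_le_pow_left₀ (hx0 i) (hxy i) _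
      have h3 := mul_le_mul_of_nonneg_left h2 hα0
      simp only [hprod, hprodx]
      linarith
    have hN : ∑ i, y i ^ (m + 1) = ∑ i, x i ^ (m + 1) + n * ε ^ (m + 1) := by
      have : ∀ i, y i ^ (m + 1) = x i ^ (m + 1) + if i ∈ Z then ε ^ (m + 1) else 0 := by
        intro i
        simp only [hy]; split_ifs with h
        · rw [(Finset.mem_filter.1 h).2]; simp
        · simp
      rw [Finset.sum_congr rfl fun i _ => this i, Finset.sum_add_distrib]
      simp [hn]
    have h5 := hmax y hy0
    rw [hN] at h5
    have h6 : (1 - α) * (m + 1) * (ε ^ n * c) ≤ M * (n * ε ^ (m + 1)) := by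
      nlinarith
    have hM : 0 ≤ M * (n : ℝ) := by
      have h7 : 0 ≤ (1 - α) * (m + 1) * (ε ^ n * c) :=
        mul_nonneg (mul_nonneg (by linarith) (by positivity)) (by positivity)
      have h8 : 0 ≤ (M * n) * ε ^ (m + 1) := by linarith
      exact nonneg_of_mul_nonneg_left h8 (by positivity)
    have h9 : ε ^ (m + 1) ≤ ε ^ (n + 1) := pow_le_pow_of_le_one hε.le hε1 (by omega)
    have h10 : ((1 - α) * (m + 1) * c) * ε ^ n ≤ (M * n * ε) * ε ^ n := by
      calc ((1 - α) * (m + 1) * c) * ε ^ n = (1 - α) * (m + 1) * (ε ^ n * c) := by ring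
        _ ≤ M * n * ε ^ (m + 1) := by linarith
        _ ≤ M * n * ε ^ (n + 1) := mul_le_mul_of_nonneg_left h9 hM
        _ = _ := by ring
    exact le_of_mul_le_mul_right h10 (by positivity)
  set c' := (1 - α) * (m + 1) * c with hc'
  have hc'pos : 0 < c' := mul_pos (mul_pos (by linarith) (by positivity)) hcpos
  have hMn : 0 < M * n := by
    have := key 1 one_pos le_rfl
    linarith
  -- This `ε` makes the right side of `key` at most `c' / 2`, while the left side is `c' > 0`.
  have h := key (min 1 (c' / (2 * (M * n)))) (lt_min one_pos (by positivity)) (min_le_left _ _)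
  have h' := mul_le_mul_of_nonneg_left (min_le_right 1 (c' / (2 * (M * n)))) hMn.le
  have h'' : M * n * (c' / (2 * (M * n))) = c' / 2 := by
    rw [mul_div_assoc', mul_comm (2 : ℝ), mul_div_mul_left _ _ hMn.ne']
  linarith

/-- Along the coordinate `i`, the form minus `M` times the power sum is nonpositive on `t ≥ 0` and
zero at the interior point `x i`. Its derivative vanishes there, and dividing by `m + 1` gives the
eigenvalue equation. -/
lemma familyForm_maximizer_eigen {m : ℕ} {α : ℝ} {E : Finset (Finset ι)}
    {x : ι → ℝ} {M : ℝ} (hx0 : ∀ i, 0 < x i)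
    (hxM : familyForm m α E x = M * ∑ i, x i ^ (m + 1))
    (hmax : ∀ y : ι → ℝ, (∀ i, 0 ≤ y i) → familyForm m α E y ≤ M * ∑ i, y i ^ (m + 1)) (i : ι) :
    M * x i ^ m = ∑ e ∈ E with i ∈ e, (α * x i ^ m + (1 - α) * ∏ j ∈ e.erase i, x j) := by
  set f : ℝ → ℝ := fun t => ∑ e ∈ E with i ∈ e, (α * (t ^ (m + 1) - x i ^ (m + 1)) +
        (1 - α) * (m + 1) * ((t - x i) * ∏ j ∈ e.erase i, x j)) -
        M * (t ^ (m + 1) - x i ^ (m + 1)) with hf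
  have hle : ∀ t, 0 ≤ t → f t ≤ 0 := by
    intro t ht
    have h1 := hmax (Function.update x i t) fun j => by
      by_cases hj : j = i
      · subst hj; simpa using ht
      · simpa [hj] using (hx0 j).le
    have h2 : ∑ j, Function.update x i t j ^ (m + 1) =
        ∑ j, x j ^ (m + 1) + (t ^ (m + 1) - x i ^ (m + 1)) := by
      rw [← Finset.add_sum_erase _ _ (Finset.mem_univ i),
        ← Finset.add_sum_erase _ (fun j => x j ^ (m + 1)) (Finset.mem_univ i),
        Finset.sum_congr rfl (g := fun j => x j ^ (m + 1)) fun j hj => by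
        rw [Function.update_of_ne (Finset.ne_of_mem_erase hj)]]
      simp only [Function.update_self]
      ring
    rw [familyForm_update, h2, hxM] at h1
    simp only [hf]
    linarith
  have hf0 : f (x i) = 0 := by simp [hf]
  have hmaxf : IsLocalMax f (x i) := by
    filter_upwards [lt_mem_nhds (hx0 i)] with t ht
    rw [hf0]
    exact hle t ht.le
  have hd : HasDerivAt f (∑ e ∈ E with i ∈ e, (α * (((m + 1 : ℕ) : ℝ) * x i ^ m) +
        (1 - α) * (m + 1) * (1 * ∏ j ∈ e.erase i, x j)) -
        M * (((m + 1 : ℕ) : ℝ) * x i ^ m)) (x i) := by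
    refine HasDerivAt.sub ?_ ?_
    · refine HasDerivAt.fun_sum fun e _ => ?_
      refine HasDerivAt.add ?_ ?_
      · exact ((hasDerivAt_pow (m + 1) (x i)).sub_const _).const_mul _
      · exact ((((hasDerivAt_id (x i)).sub_const _).mul_const _).const_mul _)
    · exact ((hasDerivAt_pow (m + 1) (x i)).sub_const _).const_mul _
  have h0 := hmaxf.hasDerivAt_eq_zero hd
  have h1 : ∑ e ∈ E with i ∈ e, (α * (((m + 1 : ℕ) : ℝ) * x i ^ m) +
        (1 - α) * (m + 1) * (1 * ∏ j ∈ e.erase i, x j)) =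
        (m + 1) * ∑ e ∈ E with i ∈ e, (α * x i ^ m + (1 - α) * ∏ j ∈ e.erase i, x j) := by
    rw [Finset.mul_sum]
    refine Finset.sum_congr rfl fun e _ => ?_
    push_cast; ring
  rw [h1] at h0
  have hm : (0 : ℝ) < m + 1 := by positivity
  push_cast at h0
  have h2 : ((m : ℝ) + 1) * (∑ e ∈ E with i ∈ e, (α * x i ^ m + (1 - α) * ∏ j ∈ e.erase i, x j)
    - M * x i ^ m) = 0 := by linarith
  rcases mul_eq_zero.1 h2 with h3 | h3
  · linarith
  · linarith

lemma familyForm_euler {m : ℕ} {α : ℝ} {E : Finset (Finset ι)} (hE : ∀ e ∈ E, e.card = m + 1)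
    (x : ι → ℝ) :
    ∑ i, x i * ∑ e ∈ E with i ∈ e, (α * x i ^ m + (1 - α) * ∏ j ∈ e.erase i, x j) =
      familyForm m α E x := by
  have h1 : ∀ i, x i * ∑ e ∈ E with i ∈ e, (α * x i ^ m + (1 - α) * ∏ j ∈ e.erase i, x j) =
      ∑ e ∈ E, if i ∈ e then α * x i ^ (m + 1) + (1 - α) * ∏ j ∈ e, x j else 0 := by
    intro i
    rw [Finset.mul_sum, Finset.sum_filter]
    refine Finset.sum_congr rfl fun e _ => ?_
    split_ifs with h
    · rw [← Finset.mul_prod_erase e x h]; ring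
    · rfl
  rw [Finset.sum_congr rfl fun i _ => h1 i, Finset.sum_comm]
  unfold familyForm
  refine Finset.sum_congr rfl fun e he => ?_
  rw [← Finset.sum_filter, Finset.filter_mem_eq_inter, Finset.univ_inter, Finset.sum_add_distrib,
    ← Finset.mul_sum, Finset.sum_const, hE e he]
  simp only [nsmul_eq_mul]
  push_cast; ring

/-- The triangle inequality makes the vector of moduli a subsolution. Pairing it with itself,
through `familyForm_euler`, bounds `‖μ‖` by the value of the form. -/
lemma norm_eigenvalue_le {m : ℕ} {α : ℝ} (hα0 : 0 ≤ α) (hα1 : α < 1)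
    {E : Finset (Finset ι)} (hE : ∀ e ∈ E, e.card = m + 1) {M : ℝ}
    (hmax : ∀ y : ι → ℝ, (∀ i, 0 ≤ y i) → familyForm m α E y ≤ M * ∑ i, y i ^ (m + 1))
    {μ : ℂ} {z : ι → ℂ} (hz : z ≠ 0)
    (hμ : ∀ i, ∑ e ∈ E with i ∈ e, ((α : ℂ) * z i ^ m + (1 - (α : ℂ)) * ∏ j ∈ e.erase i, z j) =
      μ * z i ^ m) : ‖μ‖ ≤ M := by
  set x : ι → ℝ := fun i => ‖z i‖ with hx
  have h1 : ∀ i, ‖μ‖ * x i ^ m ≤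
      ∑ e ∈ E with i ∈ e, (α * x i ^ m + (1 - α) * ∏ j ∈ e.erase i, x j) := by
    intro i
    have h2 : ‖μ‖ * x i ^ m = ‖μ * z i ^ m‖ := by simp [hx]
    rw [h2, ← hμ i]
    refine (norm_sum_le _ _).trans (Finset.sum_le_sum fun e _ => ?_)
    refine (norm_add_le _ _).trans (le_of_eq ?_)
    have h3 : (1 - (α : ℂ)) = ((1 - α : ℝ) : ℂ) := by push_cast; rfl
    rw [h3, norm_mul, norm_mul, norm_pow, Complex.norm_real, Complex.norm_real, norm_prod,
      Real.norm_of_nonneg hα0, Real.norm_of_nonneg (by linarith : (0 : ℝ) ≤ 1 - α)]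
  have h2 : ‖μ‖ * ∑ i, x i ^ (m + 1) ≤ M * ∑ i, x i ^ (m + 1) := by
    refine le_trans ?_ (hmax x fun i => norm_nonneg _)
    rw [← familyForm_euler hE, Finset.mul_sum]
    refine Finset.sum_le_sum fun i _ => ?_
    have := mul_le_mul_of_nonneg_left (h1 i) (norm_nonneg (z i) : 0 ≤ x i)
    calc ‖μ‖ * x i ^ (m + 1) = x i * (‖μ‖ * x i ^ m) := by ring
      _ ≤ _ := this
  refine le_of_mul_le_mul_right h2 ?_
  obtain ⟨i, hi⟩ := Function.ne_iff.1 hz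
  exact Finset.sum_pos' (fun j _ => by positivity) ⟨i, Finset.mem_univ i, by
    have : 0 < x i := norm_pos_iff.2 hi
    positivity⟩

end Family

end Hypergraph

namespace Hypergraph

/-! ### The tensor of a hypergraph as a family of finite sets -/

/-- Such tuples are the enumerations of `e.erase i`. Their number cancels the factor `1 / m!` in the
adjacency tensor. -/
lemma card_filter_insert_image_eq {ι : Type*} [Fintype ι] [DecidableEq ι] {m : ℕ} {e : Finset ι}
    (he : e.card = m + 1) {i : ι} (hi : i ∈ e) :
    (Finset.univ.filter fun f : Fin m → ι => insert i (Finset.univ.image f) = e).card =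
      m.factorial := by
  have hcard : Fintype.card (Fin m) = Fintype.card (e.erase i) := by
    rw [Fintype.card_coe, Finset.card_erase_of_mem hi, he]; simp
  have h : Fintype.card (Fin m ≃ e.erase i) = m.factorial := by
    rw [Fintype.card_equiv (Fintype.equivOfCardEq hcard), Fintype.card_fin]
  rw [← h, ← Finset.card_univ]
  symm
  refine Finset.card_bij (fun g _ j => (g j : ι)) (fun g _ => ?_) (fun g _ g' _ hgg' => ?_)
    (fun f hf => ?_)
  · simp only [Finset.mem_filter, Finset.mem_univ, true_and]
    have : Finset.univ.image (fun j => (g j : ι)) = e.erase i := by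
      ext a
      simp only [Finset.mem_image, Finset.mem_univ, true_and]
      constructor
      · rintro ⟨j, rfl⟩
        exact (g j).2
      · intro ha
        exact ⟨g.symm ⟨a, ha⟩, by simp⟩
    rw [this, Finset.insert_erase hi]
  · ext j
    exact congrFun hgg' j
  · have hf' : insert i (Finset.univ.image f) = e := (Finset.mem_filter.1 hf).2
    have hle : (Finset.univ.image f).card ≤ m := by
      simpa using Finset.card_image_le (s := (Finset.univ : Finset (Fin m))) (f := f)
    have hni : i ∉ Finset.univ.image f := by
      intro hmem
      rw [Finset.insert_eq_of_mem hmem] at hf'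
      rw [hf'] at hle
      omega
    have himg : Finset.univ.image f = e.erase i := by
      rw [← hf', Finset.erase_insert hni]
    have hinj : Function.Injective f := by
      have h1 : Set.InjOn f (Finset.univ : Finset (Fin m)) :=
        Finset.card_image_iff.1 (by simp [himg, Finset.card_erase_of_mem hi, he])
      rwa [Finset.coe_univ, Set.injOn_univ] at h1
    have hmem : ∀ j, f j ∈ e.erase i := fun j => himg ▸ Finset.mem_image_of_mem f (Finset.mem_univ j)
    refine ⟨Equiv.ofBijective (fun j => ⟨f j, hmem j⟩)
      ((Fintype.bijective_iff_injective_and_card _).2 ⟨fun a b hab => hinj ?_, hcard⟩),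
      Finset.mem_univ _, rfl⟩
    simpa using hab

lemma prod_eq_of_insert_image_eq {ι : Type*} [DecidableEq ι] {m : ℕ} {e : Finset ι}
    (he : e.card = m + 1) {i : ι} {f : Fin m → ι}
    (hf : insert i (Finset.univ.image f) = e) (x : ι → ℂ) :
    ∏ j, x (f j) = ∏ j ∈ e.erase i, x j := by
  have hle : (Finset.univ.image f).card ≤ m := by
    simpa using Finset.card_image_le (s := (Finset.univ : Finset (Fin m))) (f := f)
  have hni : i ∉ Finset.univ.image f := by
    intro hmem
    rw [Finset.insert_eq_of_mem hmem] at hf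
    rw [hf] at hle
    omega
  have himg : Finset.univ.image f = e.erase i := by
    rw [← hf, Finset.erase_insert hni]
  have hcard : (Finset.univ.image f).card = (Finset.univ : Finset (Fin m)).card := by
    have := Finset.card_insert_of_notMem hni
    rw [hf, he] at this
    simp; omega
  rw [← himg, Finset.prod_image (Finset.card_image_iff.1 hcard)]

variable {V : Type*}

open Classical in
/-- The edges of a hypergraph as finite sets of elements of its vertex set. -/
noncomputable def edgeFamily (H : Hypergraph V) [Fintype H.vertexSet] :
    Finset (Finset H.vertexSet) :=
  Finset.univ.filter fun e => (Subtype.val '' (e : Set H.vertexSet)) ∈ H.edgeSet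

lemma mem_edgeFamily {H : Hypergraph V} [Fintype H.vertexSet] {e : Finset H.vertexSet} :
    e ∈ H.edgeFamily ↔ (Subtype.val '' (e : Set H.vertexSet)) ∈ H.edgeSet := by
  simp [edgeFamily]

lemma image_val_coe_injective (H : Hypergraph V) :
    Function.Injective fun e : Finset H.vertexSet => Subtype.val '' (e : Set H.vertexSet) :=
  fun _ _ h => Finset.coe_injective (Subtype.val_injective.image_injective h)

lemma image_edgeFamily (H : Hypergraph V) [Fintype H.vertexSet] :
    (fun e : Finset H.vertexSet => Subtype.val '' (e : Set H.vertexSet)) ''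
      (H.edgeFamily : Set (Finset H.vertexSet)) = H.edgeSet := by
  classical
  ext e
  constructor
  · rintro ⟨f, hf, rfl⟩
    exact mem_edgeFamily.1 hf
  · intro he
    have h : Subtype.val '' ((Finset.univ.filter fun i : H.vertexSet => (i : V) ∈ e :
        Finset H.vertexSet) : Set H.vertexSet) = e := by
      ext a
      simp only [Finset.coe_filter, Finset.mem_univ, true_and, Set.mem_image]
      constructor
      · rintro ⟨b, hb, rfl⟩
        exact hb
      · intro ha
        exact ⟨⟨a, H.subset_vertexSet_of_mem_edgeSet' he ha⟩, ha, rfl⟩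
    exact ⟨_, mem_edgeFamily.2 (by rwa [h]), h⟩

lemma card_of_mem_edgeFamily {H : Hypergraph V} [Fintype H.vertexSet] {k : ℕ}
    (hH : H.IsUniform k) {e : Finset H.vertexSet} (he : e ∈ H.edgeFamily) : e.card = k := by
  have h := hH _ (mem_edgeFamily.1 he)
  rwa [Set.ncard_image_of_injective _ Subtype.val_injective, Set.ncard_coe_finset] at h

open Classical in
lemma degree_eq_card_edgeFamily (H : Hypergraph V) [Fintype H.vertexSet] (i : H.vertexSet) :
    H.degree i = (H.edgeFamily.filter fun e => i ∈ e).card := by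
  rw [← Set.ncard_coe_finset, ← Set.ncard_image_of_injective _ H.image_val_coe_injective]
  unfold degree
  congr 1
  ext e
  constructor
  · rintro ⟨he, hie⟩
    rw [← H.image_edgeFamily] at he
    obtain ⟨f, hf, rfl⟩ := he
    refine ⟨f, ?_, rfl⟩
    obtain ⟨j, hj, hji⟩ := hie
    have : j = i := Subtype.val_injective hji
    subst this
    simpa using ⟨hf, hj⟩
  · rintro ⟨f, hf, rfl⟩
    simp only [Finset.coe_filter] at hf
    exact ⟨mem_edgeFamily.1 hf.1, i, hf.2, rfl⟩

open Classical in
lemma tensorApply_alphaTensor {H : Hypergraph V} [Fintype H.vertexSet] {m : ℕ}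
    (hH : H.IsUniform (m + 1)) (α : ℝ) (x : H.vertexSet → ℂ) (i : H.vertexSet) :
    tensorApply (H.alphaTensor m α) x i =
      ∑ e ∈ H.edgeFamily with i ∈ e,
        ((α : ℂ) * x i ^ m + (1 - (α : ℂ)) * ∏ j ∈ e.erase i, x j) := by
  have hD : ∑ f : Fin m → H.vertexSet, (H.degreeTensor m (Fin.cons i f) : ℂ) * ∏ j, x (f j) =
      H.degree i * x i ^ m := by
    rw [Finset.sum_eq_single fun _ => i]
    · have : ∀ j, (Fin.cons i (fun _ => i) : Fin (m + 1) → H.vertexSet) j = i := by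
        intro j
        refine Fin.cases ?_ (fun j => ?_) j <;> simp
      simp [degreeTensor, this]
    · intro f _ hf
      have : ¬ ∀ j, (Fin.cons i f : Fin (m + 1) → H.vertexSet) j =
          (Fin.cons i f : Fin (m + 1) → H.vertexSet) 0 := by
        intro h
        refine hf (funext fun j => ?_)
        simpa using h j.succ
      unfold degreeTensor
      rw [if_neg this]
      simp
    · simp
  have hA : ∑ f : Fin m → H.vertexSet, (H.adjacencyTensor m (Fin.cons i f) : ℂ) * ∏ j, x (f j) =
      ∑ e ∈ H.edgeFamily with i ∈ e, ∏ j ∈ e.erase i, x j := by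
    have h1 : ∀ f : Fin m → H.vertexSet,
        (H.adjacencyTensor m (Fin.cons i f) : ℂ) * ∏ j, x (f j) =
        ∑ e ∈ H.edgeFamily with i ∈ e, if insert i (Finset.univ.image f) = e then
          ((m.factorial : ℂ)⁻¹ * ∏ j ∈ e.erase i, x j) else 0 := by
      intro f
      rw [Finset.sum_ite_eq]
      have hr : Set.range (fun j => ((Fin.cons i f : Fin (m + 1) → H.vertexSet) j : V)) =
          Subtype.val '' ((insert i (Finset.univ.image f) : Finset H.vertexSet) :
            Set H.vertexSet) := by
        ext a
        constructor
        · rintro ⟨j, rfl⟩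
          refine ⟨_, ?_, rfl⟩
          refine Fin.cases ?_ (fun j => ?_) j <;> simp
        · rintro ⟨b, hb, rfl⟩
          simp only [Finset.coe_insert, Finset.coe_image, Finset.coe_univ, Set.image_univ,
            Set.mem_insert_iff, Set.mem_range] at hb
          rcases hb with rfl | ⟨j, rfl⟩
          · exact ⟨0, rfl⟩
          · exact ⟨j.succ, rfl⟩
      have hiff : insert i (Finset.univ.image f) ∈ (H.edgeFamily.filter fun e => i ∈ e) ↔
          Set.range (fun j => ((Fin.cons i f : Fin (m + 1) → H.vertexSet) j : V)) ∈ H.edgeSet := by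
        rw [hr, Finset.mem_filter, mem_edgeFamily]
        simp
      unfold adjacencyTensor
      by_cases h : Set.range (fun j => ((Fin.cons i f : Fin (m + 1) → H.vertexSet) j : V)) ∈
          H.edgeSet
      · rw [if_pos h, if_pos (hiff.2 h), prod_eq_of_insert_image_eq
          (card_of_mem_edgeFamily hH (Finset.mem_filter.1 (hiff.2 h)).1) rfl]
        simp
      · rw [if_neg h, if_neg fun h' => h (hiff.1 h')]
        simp
    rw [Finset.sum_congr rfl fun f _ => h1 f, Finset.sum_comm]
    refine Finset.sum_congr rfl fun e he => ?_
    obtain ⟨he1, he2⟩ := Finset.mem_filter.1 he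
    rw [← Finset.sum_filter, Finset.sum_const,
      card_filter_insert_image_eq (card_of_mem_edgeFamily hH he1) he2, nsmul_eq_mul,
      ← mul_assoc, mul_inv_cancel₀ (by exact_mod_cast m.factorial_ne_zero), one_mul]
  unfold tensorApply alphaTensor
  rw [Finset.sum_add_distrib, Finset.sum_const, ← Finset.mul_sum, ← hA, nsmul_eq_mul,
    ← degree_eq_card_edgeFamily, mul_left_comm, ← hD, Finset.mul_sum, Finset.mul_sum,
    ← Finset.sum_add_distrib]
  refine Finset.sum_congr rfl fun f _ => ?_
  push_cast
  ring

/-! ### The form of a hypergraph and its `α`-spectral radius -/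

/-- The contribution of an edge to the form `x ↦ x · 𝒜_α x^{k - 1}`. -/
noncomputable def edgeForm (k : ℕ) (α : ℝ) (x : V → ℝ) (e : Set V) : ℝ :=
  α * ∑ᶠ w ∈ e, x w ^ k + (1 - α) * k * ∏ᶠ w ∈ e, x w

/-- The form `x ↦ x · 𝒜_α x^{k - 1}` of a `k`-uniform hypergraph, written as a sum over edges. -/
noncomputable def alphaForm (H : Hypergraph V) (k : ℕ) (α : ℝ) (x : V → ℝ) : ℝ :=
  ∑ᶠ e ∈ H.edgeSet, edgeForm k α x e

/-- The sum of the `k`-th powers of a vector over the vertex set. -/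
noncomputable def powSum (H : Hypergraph V) (k : ℕ) (x : V → ℝ) : ℝ :=
  ∑ᶠ w ∈ H.vertexSet, x w ^ k

lemma edgeForm_image_val {H : Hypergraph V} (k : ℕ) (α : ℝ) (x : V → ℝ) (e : Finset H.vertexSet) :
    edgeForm k α x (Subtype.val '' (e : Set H.vertexSet)) =
      α * ∑ i ∈ e, x i ^ k + (1 - α) * k * ∏ i ∈ e, x i := by
  unfold edgeForm
  rw [finsum_mem_image Subtype.val_injective.injOn, finprod_mem_image Subtype.val_injective.injOn,
    finsum_mem_coe_finset, finprod_mem_coe_finset]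

lemma alphaForm_eq_familyForm (H : Hypergraph V) [Fintype H.vertexSet] (m : ℕ) (α : ℝ)
    (x : V → ℝ) :
    H.alphaForm (m + 1) α x = familyForm m α H.edgeFamily fun i => x i := by
  unfold alphaForm familyForm
  rw [← H.image_edgeFamily, finsum_mem_image H.image_val_coe_injective.injOn,
    finsum_mem_coe_finset]
  refine Finset.sum_congr rfl fun e _ => ?_
  rw [edgeForm_image_val]
  push_cast
  rfl

lemma powSum_eq_sum (H : Hypergraph V) [Fintype H.vertexSet] (k : ℕ) (x : V → ℝ) :
    H.powSum k x = ∑ i : H.vertexSet, x i ^ k := by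
  unfold powSum
  rw [← finsum_set_coe_eq_finsum_mem, finsum_eq_sum_of_fintype]

lemma IsConnected.edgeFamily_closed {H : Hypergraph V} [Fintype H.vertexSet]
    (hH : H.IsConnected) (S : Set H.vertexSet) (hS : S.Nonempty)
    (hclosed : ∀ e ∈ H.edgeFamily, (∃ i ∈ e, i ∈ S) → ∀ i ∈ e, i ∈ S) (i : H.vertexSet) :
    i ∈ S := by
  obtain ⟨j, hj⟩ := hS
  have h : ∀ y, Relation.ReflTransGen H.Adj (j : V) y → ∃ h : y ∈ H.vertexSet, ⟨y, h⟩ ∈ S := by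
    intro y hy
    induction hy with
    | refl => exact ⟨j.2, hj⟩
    | tail _ hab ih =>
      obtain ⟨hb, hbS⟩ := ih
      obtain ⟨e, he, hbe, hce⟩ := hab
      rw [← H.image_edgeFamily] at he
      obtain ⟨f, hf, rfl⟩ := he
      obtain ⟨b', hb', rfl⟩ := hbe
      obtain ⟨c', hc', rfl⟩ := hce
      exact ⟨c'.2, hclosed f hf ⟨b', hb', hbS⟩ c' hc'⟩
  exact (h i (hH.2 j j.2 i i.2)).2

/-- The spectral radius of the tensor of a connected hypergraph is the maximum of its form on the
nonnegative unit sphere, and it is attained at a positive vector. -/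
theorem exists_perron_vector [Fintype V] {H : Hypergraph V} {k : ℕ} (hk : 1 ≤ k)
    {α : ℝ} (hα0 : 0 ≤ α) (hα1 : α < 1) (hunif : H.IsUniform k) (hconn : H.IsConnected) :
    (∀ x : V → ℝ, (∀ i, 0 ≤ x i) →
      H.alphaForm k α x ≤ H.alphaSpectralRadius k α * H.powSum k x) ∧
    ∃ x : V → ℝ, (∀ i, 0 < x i) ∧
      H.alphaForm k α x = H.alphaSpectralRadius k α * H.powSum k x ∧
      ∀ e ∈ H.edgeSet, ∀ i ∈ e, (∀ f ∈ H.edgeSet, i ∈ f → f = e) →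
        H.alphaSpectralRadius k α * x i ^ k = α * x i ^ k + (1 - α) * ∏ᶠ j ∈ e, x j := by
  classical
  obtain ⟨m, rfl⟩ : ∃ m, k = m + 1 := ⟨k - 1, by omega⟩
  have hE : ∀ e ∈ H.edgeFamily, e.card = m + 1 := fun e he => card_of_mem_edgeFamily hunif he
  have hne : Nonempty H.vertexSet := hconn.1.to_subtype
  obtain ⟨x, M, hx0, hx1, hxM, hmax⟩ := exists_familyForm_maximizer (α := α) hE
  have hxpos := familyForm_maximizer_pos hα0 hα1 hE hconn.edgeFamily_closed hx0 hx1 hxM hmax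
  have heig := familyForm_maximizer_eigen hxpos hxM hmax
  have hM0 : 0 ≤ M := by
    obtain ⟨i⟩ := hne
    have h1 := heig i
    have h2 : 0 ≤ M * x i ^ m := by
      rw [h1]
      refine Finset.sum_nonneg fun e _ => add_nonneg (mul_nonneg hα0 (pow_nonneg (hx0 i) _))
        (mul_nonneg (by linarith) (Finset.prod_nonneg fun j _ => hx0 j))
    exact nonneg_of_mul_nonneg_left h2 (pow_pos (hxpos i) _)
  have hρ : H.alphaSpectralRadius (m + 1) α = M := by
    unfold alphaSpectralRadius tensorSpectralRadius
    refine IsGreatest.csSup_eq ⟨⟨M, ⟨fun i => x i, ?_, fun i => ?_⟩, ?_⟩, ?_⟩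
    · obtain ⟨i⟩ := hne
      exact Function.ne_iff.2 ⟨i, by simpa using (hxpos i).ne'⟩
    · have h := tensorApply_alphaTensor hunif α (fun i => (x i : ℂ)) i
      refine (Eq.trans ?_ h).trans ?_
      · congr!
      · have := congrArg (fun r : ℝ => (r : ℂ)) (heig i)
        push_cast at this
        exact this.symm
    · rw [Complex.norm_real, Real.norm_of_nonneg hM0]
    · rintro _ ⟨μ, ⟨z, hz, hμ⟩, rfl⟩
      refine norm_eigenvalue_le hα0 hα1 hE hmax hz fun i => ?_
      rw [← tensorApply_alphaTensor hunif α z i]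
      refine Eq.trans ?_ (hμ i)
      congr!
  rw [hρ]
  -- The form and the power sum see only the vertex set; the value `1` elsewhere merely keeps the
  -- vector positive on all of `V`.
  refine ⟨fun y hy => ?_, fun a => if h : a ∈ H.vertexSet then x ⟨a, h⟩ else 1, fun a => ?_, ?_,
    fun e he i hi hunique => ?_⟩
  · rw [alphaForm_eq_familyForm, powSum_eq_sum]
    exact hmax _ fun i => hy i
  · dsimp only
    split_ifs with h
    · exact hxpos _
    · exact one_pos
  · rw [alphaForm_eq_familyForm, powSum_eq_sum]
    simpa using hxM
  · rw [← H.image_edgeFamily] at he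
    obtain ⟨f, hf, rfl⟩ := he
    obtain ⟨i, hif, rfl⟩ := hi
    have hfilter : H.edgeFamily.filter (fun e => i ∈ e) = {f} := by
      ext g
      simp only [Finset.mem_filter, Finset.mem_singleton]
      constructor
      · rintro ⟨hg, hig⟩
        exact H.image_val_coe_injective (hunique _ (mem_edgeFamily.1 hg) ⟨i, hig, rfl⟩)
      · rintro rfl
        exact ⟨hf, hif⟩
    have h := heig i
    rw [hfilter, Finset.sum_singleton] at h
    rw [finprod_mem_image Subtype.val_injective.injOn, finprod_mem_coe_finset]
    simp only [Subtype.coe_prop, dite_true, Subtype.coe_eta]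
    rw [← Finset.mul_prod_erase f x hif]
    -- Multiplying the equation at `i` by `x i` completes the product to the whole edge, so the
    -- right factor no longer depends on `i`.
    linear_combination x i * h

end Hypergraph

namespace Hypergraph

/-! ### Forms of weighted paths -/

/-- The form of an edge of a loose path whose end vertices have the values `a` and `b` and whose
other vertices have the value `y`. -/
noncomputable def pathEdgeForm (k : ℕ) (α a y b : ℝ) : ℝ :=
  α * (a ^ k + b ^ k + ((k - 2 : ℕ) : ℝ) * y ^ k) + (1 - α) * k * (a * b * y ^ (k - 2))

/-- The form of a loose path of length `L` whose joints have the values `z 0, …, z L` and whose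
`t`-th edge has the value `η t` at the other vertices. -/
noncomputable def pathForm (k : ℕ) (α : ℝ) (L : ℕ) (z η : ℕ → ℝ) : ℝ :=
  ∑ t ∈ Finset.range L, pathEdgeForm k α (z t) (η t) (z (t + 1))

/-- The sum of the `k`-th powers of the values on a loose path. -/
noncomputable def pathPowSum (k L : ℕ) (z η : ℕ → ℝ) : ℝ :=
  ∑ t ∈ Finset.range (L + 1), z t ^ k + ((k - 2 : ℕ) : ℝ) * ∑ t ∈ Finset.range L, η t ^ k

/-! ### Reversing a path and reflecting its middle part -/

lemma pathEdgeForm_comm (k : ℕ) (α a y b : ℝ) :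
    pathEdgeForm k α a y b = pathEdgeForm k α b y a := by
  unfold pathEdgeForm; ring

lemma pathForm_reverse (k : ℕ) (α : ℝ) (L : ℕ) (z η : ℕ → ℝ) :
    pathForm k α L (fun r => z (L - r)) (fun r => η (L - 1 - r)) = pathForm k α L z η := by
  unfold pathForm
  rw [← Finset.sum_range_reflect]
  refine Finset.sum_congr rfl fun r hr => ?_
  have hr := Finset.mem_range.1 hr
  rw [pathEdgeForm_comm]
  dsimp only
  congr 2 <;> omega

lemma pathPowSum_reverse (k L : ℕ) (z η : ℕ → ℝ) :
    pathPowSum k L (fun r => z (L - r)) (fun r => η (L - 1 - r)) = pathPowSum k L z η := by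
  unfold pathPowSum
  rw [← Finset.sum_range_reflect (fun r => z r ^ k), ← Finset.sum_range_reflect fun r => η r ^ k]
  rfl

/-- The reflection `r ↦ B - r` of the interval from `m` to `B - m`. -/
def reflectOn (m B r : ℕ) : ℕ := if m ≤ r ∧ r + m ≤ B then B - r else r

lemma sum_reflectOn (f : ℕ → ℝ) {m B n : ℕ} (h : B < n + m) :
    ∑ r ∈ Finset.range n, f (reflectOn m B r) = ∑ r ∈ Finset.range n, f r := by
  refine Finset.sum_nbij' (reflectOn m B) (reflectOn m B) ?_ ?_ ?_ ?_ ?_ <;> intro r hr <;>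
    simp only [Finset.mem_range, reflectOn] at hr ⊢
  · split_ifs <;> omega
  · split_ifs <;> omega
  · split_ifs <;> omega
  · split_ifs <;> omega

lemma pathPowSum_reflectOn (k : ℕ) {m n B B' L : ℕ} (h : B ≤ L + m) (h' : B' < L + n)
    (z η : ℕ → ℝ) :
    pathPowSum k L (fun r => z (reflectOn m B r)) (fun r => η (reflectOn n B' r)) =
      pathPowSum k L z η := by
  unfold pathPowSum
  rw [sum_reflectOn (fun r => z r ^ k) (by omega), sum_reflectOn (fun r => η r ^ k) h']

/-- Edges with both joints in the reflected stretch are permuted, and edges outside it are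
untouched. Only the edges `t - 1` and `L - 1 - t` straddle its boundary. The choice `m = t` leaves
their `η`-values in place; `m = t - 1` exchanges them. -/
lemma pathForm_reflectOn (k : ℕ) (α : ℝ) {t m L : ℕ} (ht : 1 ≤ t) (htL : 2 * t + 1 ≤ L)
    (hm : m ≤ t) (hm' : t ≤ m + 1) (z η : ℕ → ℝ) :
    pathForm k α L (fun r => z (reflectOn t (L - 1) r)) (fun r => η (reflectOn m (L - 2) r)) =
      pathForm k α L z η +
      (pathEdgeForm k α (z (t - 1)) (η (reflectOn m (L - 2) (t - 1))) (z (L - 1 - t)) -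
        pathEdgeForm k α (z (t - 1)) (η (t - 1)) (z t)) +
      (pathEdgeForm k α (z t) (η (reflectOn m (L - 2) (L - 1 - t))) (z (L - t)) -
        pathEdgeForm k α (z (L - 1 - t)) (η (L - 1 - t)) (z (L - t))) := by
  unfold pathForm
  rw [← sum_reflectOn _ (show L - 2 < L + t by omega)]
  have ha : t - 1 ∈ Finset.range L := Finset.mem_range.2 (by omega)
  have hb : L - 1 - t ∈ (Finset.range L).erase (t - 1) := by
    simp; omega
  rw [← Finset.add_sum_erase _ _ ha, ← Finset.add_sum_erase _ _ hb, ← Finset.add_sum_erase _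
    (fun r => pathEdgeForm k α (z r) (η r) (z (r + 1))) ha, ← Finset.add_sum_erase _
    (fun r => pathEdgeForm k α (z r) (η r) (z (r + 1))) hb]
  have hrest : ∀ r ∈ ((Finset.range L).erase (t - 1)).erase (L - 1 - t),
      pathEdgeForm k α (z (reflectOn t (L - 1) (reflectOn t (L - 2) r)))
        (η (reflectOn m (L - 2) (reflectOn t (L - 2) r)))
        (z (reflectOn t (L - 1) (reflectOn t (L - 2) r + 1))) =
      pathEdgeForm k α (z r) (η r) (z (r + 1)) := by
    intro r hr
    simp only [Finset.mem_erase, Finset.mem_range] at hr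
    by_cases hc : t ≤ r ∧ r + t ≤ L - 2
    · rw [pathEdgeForm_comm]
      congr 2 <;> simp only [reflectOn] <;> split_ifs <;> omega
    · congr 2 <;> simp only [reflectOn] <;> split_ifs <;> omega
  rw [Finset.sum_congr rfl hrest]
  have e1 : reflectOn t (L - 2) (t - 1) = t - 1 := by
    simp only [reflectOn]; split_ifs <;> omega
  have e2 : reflectOn t (L - 2) (L - 1 - t) = L - 1 - t := by
    simp only [reflectOn]; split_ifs <;> omega
  have e3 : reflectOn t (L - 1) (t - 1) = t - 1 := by
    simp only [reflectOn]; split_ifs <;> omega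
  have e4 : reflectOn t (L - 1) (t - 1 + 1) = L - 1 - t := by
    simp only [reflectOn]; split_ifs <;> omega
  have e5 : reflectOn t (L - 1) (L - 1 - t) = t := by
    simp only [reflectOn]; split_ifs <;> omega
  have e6 : reflectOn t (L - 1) (L - 1 - t + 1) = L - t := by
    simp only [reflectOn]; split_ifs <;> omega
  rw [e1, e2]
  dsimp only
  rw [e3, e4, e5, e6, show t - 1 + 1 = t by omega, show L - 1 - t + 1 = L - t by omega]
  ring

/-- For `t = 0` the stretch starts at the end of the path, so only the last edge straddles its
boundary. -/
lemma pathForm_reflectOn_zero (k : ℕ) (α : ℝ) {L : ℕ} (hL : 2 ≤ L) (z η : ℕ → ℝ) :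
    pathForm k α L (fun r => z (reflectOn 0 (L - 1) r)) (fun r => η (reflectOn 0 (L - 2) r)) =
      pathForm k α L z η + (pathEdgeForm k α (z 0) (η (L - 1)) (z L) -
        pathEdgeForm k α (z (L - 1)) (η (L - 1)) (z L)) := by
  unfold pathForm
  rw [← sum_reflectOn _ (show L - 2 < L + 0 by omega)]
  have hb : L - 1 ∈ Finset.range L := Finset.mem_range.2 (by omega)
  rw [← Finset.add_sum_erase _ _ hb, ← Finset.add_sum_erase _
    (fun r => pathEdgeForm k α (z r) (η r) (z (r + 1))) hb]
  have hrest : ∀ r ∈ (Finset.range L).erase (L - 1),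
      pathEdgeForm k α (z (reflectOn 0 (L - 1) (reflectOn 0 (L - 2) r)))
        (η (reflectOn 0 (L - 2) (reflectOn 0 (L - 2) r)))
        (z (reflectOn 0 (L - 1) (reflectOn 0 (L - 2) r + 1))) =
      pathEdgeForm k α (z r) (η r) (z (r + 1)) := by
    intro r hr
    simp only [Finset.mem_erase, Finset.mem_range] at hr
    rw [pathEdgeForm_comm]
    congr 2 <;> simp only [reflectOn] <;> split_ifs <;> omega
  rw [Finset.sum_congr rfl hrest]
  have e2 : reflectOn 0 (L - 2) (L - 1) = L - 1 := by
    simp only [reflectOn]; split_ifs <;> omega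
  have e5 : reflectOn 0 (L - 1) (L - 1) = 0 := by
    simp only [reflectOn]; split_ifs <;> omega
  have e6 : reflectOn 0 (L - 1) (L - 1 + 1) = L := by
    simp only [reflectOn]; split_ifs <;> omega
  rw [e2]
  dsimp only
  rw [e2, e5, e6, show L - 1 + 1 = L by omega]
  ring

/-- If `ρ₂ ≤ ρ₁`, then `f δ ≤ -κ * δ` for `δ ≥ 0`, which is incompatible with the zero derivative at
a local maximum. -/
lemma lt_of_slope {f N : ℝ → ℝ} {κ ρ₁ ρ₂ : ℝ} (hf : DifferentiableAt ℝ f 0) (hf0 : f 0 = 0)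
    (hmax : IsLocalMax f 0) (hκ : 0 < κ) (hN : ∀ δ, 0 ≤ δ → 0 < N δ)
    (h : ∀ δ, 0 ≤ δ → f δ + κ * δ ≤ (ρ₂ - ρ₁) * N δ) : ρ₁ < ρ₂ := by
  by_contra! hρ
  have hle : ∀ δ, 0 ≤ δ → f δ + κ * δ ≤ 0 := fun δ hδ =>
    (h δ hδ).trans (mul_nonpos_of_nonpos_of_nonneg (by linarith) (hN δ hδ).le)
  have hd : HasDerivAt f 0 0 := by
    have := hf.hasDerivAt
    rwa [hmax.deriv_eq_zero] at this
  have hev := (hasDerivAt_iff_tendsto_slope.1 hd).eventually (lt_mem_nhds (neg_lt_zero.2 hκ))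
  have hev' := hev.filter_mono (nhdsWithin_mono (0 : ℝ) (fun x (hx : x ∈ Set.Ioi 0) => hx.ne'))
  obtain ⟨δ, hδ, hδ0⟩ := (hev'.and self_mem_nhdsWithin).exists
  have hδ0 : 0 < δ := hδ0
  rw [slope_def_field, hf0, sub_zero, sub_zero, lt_div_iff₀ hδ0] at hδ
  linarith [hle δ hδ0.le]

/-- Moving the part `C` of the form, which is attached at distance `s` at two joints of a path, by
one step towards the middle of the path increases the maximum of the form on the unit sphere. -/
theorem lt_of_pathForm_le {k : ℕ} {α : ℝ} (hα0 : 0 ≤ α) (hα1 : α < 1) (hk : 3 ≤ k)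
    {p q s : ℕ} (hq : 1 ≤ q) (hqp : q ≤ p) (hs : s ≤ p - q + 1) {C : ℝ → ℝ → ℝ} {R ρ₁ ρ₂ : ℝ}
    (hR : 0 ≤ R) (hC : Differentiable ℝ fun x : ℝ × ℝ => C x.1 x.2)
    (hCmono : ∀ a a' b b', 0 < a → a < a' → 0 < b → b ≤ b' → C a b < C a' b')
    (h₁ : ∀ z η : ℕ → ℝ, (∀ r, 0 < z r) → (∀ r, 0 < η r) →
      pathForm k α (p + q + s) z η + C (z (q - 1)) (z (q - 1 + s)) ≤
        ρ₁ * (pathPowSum k (p + q + s) z η + R))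
    {z η : ℕ → ℝ} (hz : ∀ r, 0 < z r) (hη : ∀ r, 0 < η r)
    (heq : pathForm k α (p + q + s) z η + C (z (q - 1)) (z (q - 1 + s)) =
      ρ₁ * (pathPowSum k (p + q + s) z η + R))
    (h₂ : ∀ z η : ℕ → ℝ, (∀ r, 0 < z r) → (∀ r, 0 < η r) →
      pathForm k α (p + q + s) z η + C (z q) (z (q + s)) ≤
        ρ₂ * (pathPowSum k (p + q + s) z η + R)) :
    ρ₁ < ρ₂ := by
  set L := p + q + s with hL
  have hpos : ∀ z η : ℕ → ℝ, (∀ r, 0 < z r) → (∀ r, 0 < η r) → 0 < pathPowSum k L z η + R := by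
    intro z η hz hη
    have : 0 < ∑ t ∈ Finset.range (L + 1), z t ^ k :=
      Finset.sum_pos (fun t _ => pow_pos (hz t) _) ⟨0, by simp⟩
    have : 0 ≤ ((k - 2 : ℕ) : ℝ) * ∑ t ∈ Finset.range L, η t ^ k :=
      mul_nonneg (Nat.cast_nonneg _) (Finset.sum_nonneg fun t _ => (pow_pos (hη t) _).le)
    unfold pathPowSum
    linarith
  -- Reading the second path backwards puts the core at `p + s` and `p`, the images of `q - 1` and
  -- `q - 1 + s` under `r ↦ L - 1 - r`.
  have h₂' : ∀ z η : ℕ → ℝ, (∀ r, 0 < z r) → (∀ r, 0 < η r) →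
      pathForm k α L z η + C (z (p + s)) (z p) ≤ ρ₂ * (pathPowSum k L z η + R) := by
    intro z η hz hη
    have := h₂ (fun r => z (L - r)) (fun r => η (L - 1 - r)) (fun r => hz _) fun r => hη _
    rw [pathForm_reverse, pathPowSum_reverse] at this
    rwa [show L - q = p + s by omega, show L - (q + s) = p by omega] at this
  have hstrict : ∀ z' η' : ℕ → ℝ, (∀ r, 0 < z' r) → (∀ r, 0 < η' r) →
      pathPowSum k L z' η' = pathPowSum k L z η →
      pathForm k α L z η + C (z (q - 1)) (z (q - 1 + s)) <
        pathForm k α L z' η' + C (z' (p + s)) (z' p) → ρ₁ < ρ₂ := by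
    intro z' η' hz' hη' hN hlt
    have h := h₂' z' η' hz' hη'
    rw [heq] at hlt
    rw [hN] at h
    exact lt_of_mul_lt_mul_right (hlt.trans_le h) (hpos z η hz hη).le
  have hk0 : 0 < (1 - α) * (k : ℝ) := mul_pos (by linarith) (by positivity)
  by_cases hex : ∃ t, t ≤ q - 1 + s ∧ z (L - 1 - t) ≤ z t
  swap
  · push Not at hex
    refine hstrict z η hz hη rfl ?_
    have h1 := hex (q - 1) (by omega)
    have h2 := hex (q - 1 + s) le_rfl
    rw [show L - 1 - (q - 1) = p + s by omega] at h1
    rw [show L - 1 - (q - 1 + s) = p by omega] at h2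
    linarith [hCmono _ _ _ _ (hz (q - 1)) h1 (hz (q - 1 + s)) h2.le]
  classical
  obtain ⟨htle, htz⟩ := Nat.find_spec hex
  have hmin : ∀ r, r < Nat.find hex → z r < z (L - 1 - r) := by
    intro r hr
    have := Nat.find_min hex hr
    push Not at this
    exact this (by omega)
  generalize Nat.find hex = t at htle htz hmin
  -- This is where `s ≤ p - q + 1` enters: it gives `t ≤ q - 1 + s ≤ p`, hence `t ≤ L - 1 - t`.
  have htL : 2 * t + 1 ≤ L := by omega
  have hN : ∀ (z : ℕ → ℝ) (m : ℕ), pathPowSum k L (fun r => z (reflectOn t (L - 1) r))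
      (fun r => η (reflectOn m (L - 2) r)) = pathPowSum k L z η := fun z m =>
    pathPowSum_reflectOn k (by omega) (by omega) z η
  -- the values at the two ends of the attached part after the reflection
  have hends : (t ≤ q - 1 → ∀ z : ℕ → ℝ, z (reflectOn t (L - 1) (p + s)) = z (q - 1)) ∧
      (q - 1 < t → z (reflectOn t (L - 1) (p + s)) = z (p + s)) ∧
      ∀ z : ℕ → ℝ, z (reflectOn t (L - 1) p) = z (q - 1 + s) := by
    refine ⟨fun h z => ?_, fun h => ?_, fun z => ?_⟩ <;> congr 1 <;> simp only [reflectOn] <;>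
      split_ifs <;> omega
  obtain ⟨hend1, hend2, hend3⟩ := hends
  -- With both core ends reflected, the core contributes equally on both sides and the power sums
  -- agree. A gain of at least `κ * δ` on the path, after raising `z t` by `δ`, is then enough.
  have hslope : ∀ κ, 0 < κ → t ≤ q - 1 → (∀ δ, 0 ≤ δ → ∀ z' : ℕ → ℝ,
      (z' = fun r => z r + (if r = t then 1 else 0) * δ) →
      pathForm k α L z' η + κ * δ ≤ pathForm k α L (fun r => z' (reflectOn t (L - 1) r))
        (fun r => η (reflectOn t (L - 2) r))) → ρ₁ < ρ₂ := by
    intro κ hκ htq hgain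
    set w : ℝ → ℕ → ℝ := fun δ r => z r + (if r = t then 1 else 0) * δ with hw
    have hw0 : w 0 = z := by ext r; simp [hw]
    have hwpos : ∀ δ, -z t < δ → ∀ r, 0 < w δ r := by
      intro δ hδ r
      simp only [hw]
      split_ifs with h
      · subst h; linarith
      · simpa using hz r
    have hwpos' : ∀ δ, 0 ≤ δ → ∀ r, 0 < w δ r := fun δ hδ =>
      hwpos δ (lt_of_lt_of_le (neg_lt_zero.2 (hz t)) hδ)
    refine lt_of_slope (f := fun δ => pathForm k α L (w δ) η + C (w δ (q - 1)) (w δ (q - 1 + s)) -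
      ρ₁ * (pathPowSum k L (w δ) η + R)) (N := fun δ => pathPowSum k L (w δ) η + R) (κ := κ)
      ?_ ?_ ?_ hκ (fun δ hδ => hpos _ _ (hwpos' δ hδ) hη) ?_
    · refine DifferentiableAt.sub (DifferentiableAt.add ?_ ?_) ?_
      · unfold pathForm pathEdgeForm
        fun_prop
      · exact (hC.comp (g := fun x : ℝ × ℝ => C x.1 x.2)
          (f := fun δ : ℝ => (w δ (q - 1), w δ (q - 1 + s))) (by fun_prop)).differentiableAt
      · unfold pathPowSum
        fun_prop
    · simp only [hw0]; linarith
    · filter_upwards [lt_mem_nhds (neg_lt_zero.2 (hz t))] with δ hδ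
      simp only [hw0]
      linarith [h₁ (w δ) η (hwpos δ hδ) hη]
    · intro δ hδ
      have h3 := h₂' (fun r => w δ (reflectOn t (L - 1) r)) (fun r => η (reflectOn t (L - 2) r))
        (fun r => hwpos' δ hδ _) fun r => hη _
      rw [hN, hend1 htq (w δ), hend3 (w δ)] at h3
      linarith [hgain δ hδ (w δ) rfl]
  rcases Nat.eq_zero_or_pos t with ht0 | ht0
  · subst ht0
    refine hslope ((1 - α) * k * (z L * η (L - 1) ^ (k - 2)))
      (mul_pos hk0 (mul_pos (hz _) (pow_pos (hη _) _))) (by omega) ?_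
    rintro δ hδ z' hz'
    rw [pathForm_reflectOn_zero k α (by omega)]
    have e0 : z' 0 = z 0 + δ := by simp [hz']
    have e1 : z' (L - 1) = z (L - 1) := by simp [hz', show L - 1 ≠ 0 by omega]
    have e2 : z' L = z L := by simp [hz', show L ≠ 0 by omega]
    rw [e0, e1, e2]
    unfold pathEdgeForm
    have h1 : z (L - 1) + δ ≤ z 0 + δ := by simpa using htz
    have h2 : z (L - 1) ^ k ≤ (z 0 + δ) ^ k := pow_le_pow_left₀ (hz _).le (by linarith) _
    have h3 := mul_le_mul_of_nonneg_left h2 hα0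
    have h4 := mul_le_mul_of_nonneg_left h1 (mul_pos hk0 (mul_pos (hz L)
      (pow_pos (hη (L - 1)) (k - 2)))).le
    linarith
  · set Y := η (L - 1 - t) ^ (k - 2) with hY
    set Y' := η (t - 1) ^ (k - 2) with hY'
    have hYpos : 0 < Y := pow_pos (hη _) _
    have hY'pos : 0 < Y' := pow_pos (hη _) _
    have hb : z (t - 1) < z (L - t) := by
      have := hmin (t - 1) (by omega)
      rwa [show L - 1 - (t - 1) = L - t by omega] at this
    have r1 : reflectOn t (L - 2) (t - 1) = t - 1 := by
      simp only [reflectOn]; split_ifs <;> omega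
    have r2 : reflectOn t (L - 2) (L - 1 - t) = L - 1 - t := by
      simp only [reflectOn]; split_ifs <;> omega
    have r3 : reflectOn (t - 1) (L - 2) (t - 1) = L - 1 - t := by
      simp only [reflectOn]; split_ifs <;> omega
    have r4 : reflectOn (t - 1) (L - 2) (L - 1 - t) = t - 1 := by
      simp only [reflectOn]; split_ifs <;> omega
    have hI : ∀ z : ℕ → ℝ, pathForm k α L (fun r => z (reflectOn t (L - 1) r))
        (fun r => η (reflectOn t (L - 2) r)) = pathForm k α L z η +
        (1 - α) * k * ((z t - z (L - 1 - t)) * (Y * z (L - t) - Y' * z (t - 1))) := by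
      intro z
      rw [pathForm_reflectOn k α ht0 htL le_rfl (by omega), r1, r2]
      unfold pathEdgeForm
      ring
    have hII : pathForm k α L (fun r => z (reflectOn t (L - 1) r))
        (fun r => η (reflectOn (t - 1) (L - 2) r)) = pathForm k α L z η +
        (1 - α) * k * ((z (L - t) - z (t - 1)) * (Y' * z t - Y * z (L - 1 - t))) := by
      rw [pathForm_reflectOn k α ht0 htL (by omega) (by omega), r3, r4]
      unfold pathEdgeForm
      ring
    -- Minimality of `t` gives `z (t - 1) < z (L - t)`. If `Y < Y'`, exchanging the boundary
    -- `η`-values makes the gain in `hII` strictly positive. If `Y' ≤ Y`, keeping them makes the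
    -- second factor in `hI` strictly positive, while the first is only nonnegative.
    rcases lt_or_ge Y Y' with hYY | hYY
    · have hgain : 0 < (1 - α) * k * ((z (L - t) - z (t - 1)) * (Y' * z t - Y * z (L - 1 - t))) := by
        refine mul_pos hk0 (mul_pos (by linarith) ?_)
        have h1 : Y * z (L - 1 - t) ≤ Y * z t := mul_le_mul_of_nonneg_left htz hYpos.le
        have h2 : Y * z t < Y' * z t := mul_lt_mul_of_pos_right hYY (hz t)
        linarith
      refine hstrict (fun r => z (reflectOn t (L - 1) r))
        (fun r => η (reflectOn (t - 1) (L - 2) r)) (fun r => hz _) (fun r => hη _) (hN z _) ?_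
      rw [hII]
      rw [hend3 z]
      rcases Nat.lt_or_ge (q - 1) t with htq | htq
      · have h1 := hmin (q - 1) htq
        rw [show L - 1 - (q - 1) = p + s by omega] at h1
        rw [hend2 htq]
        linarith [hCmono _ _ _ _ (hz (q - 1)) h1 (hz (q - 1 + s)) le_rfl]
      · rw [hend1 htq z]
        linarith
    · have hκ : 0 < Y * z (L - t) - Y' * z (t - 1) := by
        have h1 : Y' * z (t - 1) ≤ Y * z (t - 1) := mul_le_mul_of_nonneg_right hYY (hz _).le
        have h2 : Y * z (t - 1) < Y * z (L - t) := mul_lt_mul_of_pos_left hb hYpos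
        linarith
      -- For `q - 1 < t` strictness comes from the core, whose value at `v` increases from `z (q -
      -- 1)` to `z (p + s)`. Otherwise `z t = z (L - 1 - t)` is possible and the first-order
      -- argument is needed.
      rcases Nat.lt_or_ge (q - 1) t with htq | htq
      · refine hstrict (fun r => z (reflectOn t (L - 1) r))
          (fun r => η (reflectOn t (L - 2) r)) (fun r => hz _) (fun r => hη _) (hN z _) ?_
        rw [hI]
        have h1 := hmin (q - 1) htq
        rw [show L - 1 - (q - 1) = p + s by omega] at h1
        rw [hend3 z, hend2 htq]
        have h2 : 0 ≤ (1 - α) * k * ((z t - z (L - 1 - t)) * (Y * z (L - t) - Y' * z (t - 1))) :=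
          mul_nonneg hk0.le (mul_nonneg (by linarith) hκ.le)
        linarith [hCmono _ _ _ _ (hz (q - 1)) h1 (hz (q - 1 + s)) le_rfl]
      · refine hslope ((1 - α) * k * (Y * z (L - t) - Y' * z (t - 1))) (mul_pos hk0 hκ) htq ?_
        rintro δ hδ z' hz'
        rw [hI]
        have e0 : z' t = z t + δ := by simp [hz']
        have e1 : z' (L - 1 - t) = z (L - 1 - t) := by
          simp [hz', show L - 1 - t ≠ t by omega]
        have e2 : z' (L - t) = z (L - t) := by simp [hz', show L - t ≠ t by omega]
        have e3 : z' (t - 1) = z (t - 1) := by simp [hz', show t - 1 ≠ t by omega]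
        rw [e0, e1, e2, e3]
        have h1 := mul_nonneg (mul_pos hk0 hκ).le (sub_nonneg.2 htz)
        linarith

end Hypergraph

namespace Hypergraph

/-! ### Loose paths -/

section LoosePath

variable {V : Type*} {H : Hypergraph V} {d : ℕ} {w : Fin (d + 1) → V} {e : Fin d → Set V}

/-- The one-element intersection of consecutive edges already contains their common joint. -/
lemma IsLoosePath.eq_of_mem_of_mem (h : H.IsLoosePath d w e) {i j : Fin d} (hij : i < j) {x : V}
    (hi : x ∈ e i) (hj : x ∈ e j) : i.val + 1 = j.val ∧ x = w j.castSucc := by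
  have hij' : i.val < j.val := hij
  by_cases hc : i.val + 1 = j.val
  · refine ⟨hc, ?_⟩
    obtain ⟨a, ha⟩ := Set.ncard_eq_one.1 (h.inter_consecutive i j hc)
    have h1 : x ∈ e i ∩ e j := ⟨hi, hj⟩
    have h2 : w j.castSucc ∈ e i ∩ e j := by
      refine ⟨?_, h.left_mem j⟩
      have : j.castSucc = i.succ := Fin.ext (by simp [hc])
      rw [this]
      exact h.right_mem i
    rw [ha] at h1 h2
    rw [Set.mem_singleton_iff.1 h1, Set.mem_singleton_iff.1 h2]
  · have h1 : x ∈ e i ∩ e j := ⟨hi, hj⟩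
    rw [h.inter_far i j (by omega)] at h1
    exact h1.elim

lemma IsLoosePath.eq_or_eq_of_mem (h : H.IsLoosePath d w e) {i : Fin (d + 1)} {j : Fin d}
    (hi : w i ∈ e j) : i = j.castSucc ∨ i = j.succ := by
  by_contra! hc
  have h1 : i.val ≠ j.val := fun h' => hc.1 (Fin.ext h')
  have h2 : i.val ≠ j.val + 1 := fun h' => hc.2 (Fin.ext h')
  rcases lt_or_gt_of_ne h1 with hlt | hgt
  · set a : Fin d := ⟨i.val, hlt.trans j.2⟩ with ha
    have hai : a.castSucc = i := Fin.ext rfl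
    have h3 := h.eq_of_mem_of_mem (i := a) (j := j) hlt (hai ▸ h.left_mem a) hi
    have h4 : j.castSucc = a.succ := Fin.ext (by simpa using h3.1.symm)
    exact h.left_ne_right a (by rw [hai, ← h4]; exact h3.2)
  · set a : Fin d := ⟨i.val - 1, by omega⟩ with ha
    have hai : a.succ = i := Fin.ext (by simp [ha]; omega)
    have h3 := h.eq_of_mem_of_mem (i := j) (j := a) (Fin.lt_def.2 (by simp [ha]; omega)) hi
      (hai ▸ h.right_mem a)
    exact h.left_ne_right a (by rw [hai]; exact h3.2.symm)

lemma IsLoosePath.vertex_injective (h : H.IsLoosePath d w e) : Function.Injective w := by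
  have key : ∀ i j : Fin (d + 1), i < j → w i ≠ w j := by
    intro i j hij hw
    have hij' : i.val < j.val := hij
    set a : Fin d := ⟨i.val, by omega⟩ with ha
    have hai : a.castSucc = i := Fin.ext rfl
    have h1 : w j ∈ e a := by rw [← hw, ← hai]; exact h.left_mem a
    rcases h.eq_or_eq_of_mem h1 with h2 | h2
    · rw [hai] at h2
      exact hij.ne' h2
    · exact h.left_ne_right a (by rw [hai, ← h2]; exact hw)
  intro i j hij
  by_contra hne
  rcases lt_or_gt_of_ne hne with h1 | h1
  · exact key _ _ h1 hij
  · exact key _ _ h1 hij.symm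

lemma IsLoosePath.ne_of_mem_edge (h : H.IsLoosePath d w e) {j : Fin d} {x : V} (hx : x ∈ e j)
    (h1 : x ≠ w j.castSucc) (h2 : x ≠ w j.succ) (i : Fin (d + 1)) : x ≠ w i := by
  rintro rfl
  rcases h.eq_or_eq_of_mem hx with rfl | rfl
  · exact h1 rfl
  · exact h2 rfl

lemma IsLoosePath.eq_edge_of_mem (h : H.IsLoosePath d w e) {i j : Fin d} {x : V} (hx : x ∈ e j)
    (h1 : ∀ i, x ≠ w i) (hi : x ∈ e i) : i = j := by
  by_contra hne
  rcases lt_or_gt_of_ne hne with h2 | h2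
  · exact h1 _ (h.eq_of_mem_of_mem h2 hi hx).2
  · exact h1 _ (h.eq_of_mem_of_mem h2 hx hi).2

/-- A loose path whose edges and vertices are images under an injective map is the image of a
loose path. -/
lemma IsLoosePath.of_image {W : Type*} {K : Hypergraph W} {f : V → W}
    (hf : Function.Injective f) (h : K.IsLoosePath d (fun i => f (w i)) (fun i => f '' e i))
    (hw : ∀ i, w i ∈ H.vertexSet) (he : ∀ i, e i ∈ H.edgeSet) : H.IsLoosePath d w e where
  vertex_mem := hw
  edge_mem := he
  edge_injective i j hij := h.edge_injective (by simp only [hij])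
  inter_consecutive i j hij := by
    have := h.inter_consecutive i j hij
    rwa [← Set.image_inter hf, Set.ncard_image_of_injective _ hf] at this
  inter_far i j hij := by
    have := h.inter_far i j hij
    rwa [← Set.image_inter hf, Set.image_eq_empty] at this
  left_mem i := hf.mem_set_image.1 (h.left_mem i)
  right_mem i := hf.mem_set_image.1 (h.right_mem i)
  left_ne_right i hi := h.left_ne_right i (by simp only [hi])

end LoosePath

/-! ### The form on an edge of a loose path -/

section EdgeForm

variable {V : Type*}

lemma edgeForm_congr {k : ℕ} {α : ℝ} {x y : V → ℝ} {e : Set V} (h : ∀ w ∈ e, x w = y w) :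
    edgeForm k α x e = edgeForm k α y e := by
  unfold edgeForm
  rw [finsum_mem_congr rfl fun w hw => by rw [h w hw], finprod_mem_congr rfl h]

lemma edgeForm_image {W : Type*} {f : V → W} (hf : Function.Injective f) (k : ℕ) (α : ℝ)
    (x : W → ℝ) (e : Set V) : edgeForm k α x (f '' e) = edgeForm k α (fun a => x (f a)) e := by
  unfold edgeForm
  rw [finsum_mem_image hf.injOn, finprod_mem_image hf.injOn]

lemma finsum_mem_sdiff_pair {e : Set V} (he : e.Finite) {A B : V} (hA : A ∈ e) (hB : B ∈ e)
    (hAB : A ≠ B) (f : V → ℝ) :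
    ∑ᶠ w ∈ e, f w = f A + f B + ∑ᶠ w ∈ e \ {A, B}, f w := by
  rw [← finsum_mem_pair hAB, finsum_mem_add_sdiff _ he]
  rintro _ (rfl | rfl) <;> assumption

lemma ncard_sdiff_pair {e : Set V} {A B : V} (hA : A ∈ e) (hB : B ∈ e) (hAB : A ≠ B) :
    (e \ {A, B}).ncard = e.ncard - 2 := by
  rw [Set.ncard_sdiff, Set.ncard_pair hAB]
  rintro _ (rfl | rfl) <;> assumption

lemma edgeForm_eq_pathEdgeForm {k : ℕ} (hk : 2 ≤ k) (α : ℝ) {e : Set V} (he : e.ncard = k)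
    {A B : V} (hA : A ∈ e) (hB : B ∈ e) (hAB : A ≠ B) {x : V → ℝ} {y : ℝ}
    (hy : ∀ w ∈ e, w ≠ A → w ≠ B → x w = y) :
    edgeForm k α x e = pathEdgeForm k α (x A) y (x B) := by
  have hfin : e.Finite := Set.finite_of_ncard_pos (by omega)
  have hsub : ({A, B} : Set V) ⊆ e := by rintro _ (rfl | rfl) <;> assumption
  have hfin' : (e \ {A, B}).Finite := hfin.sdiff
  have hcard : hfin'.toFinset.card = k - 2 := by
    rw [← Set.ncard_eq_toFinset_card _ hfin', ncard_sdiff_pair hA hB hAB, he]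
  have hmem : ∀ w ∈ e \ {A, B}, x w = y := by
    rintro w ⟨hw, hw'⟩
    simp only [Set.mem_insert_iff, Set.mem_singleton_iff, not_or] at hw'
    exact hy w hw hw'.1 hw'.2
  unfold edgeForm pathEdgeForm
  rw [finsum_mem_sdiff_pair hfin hA hB hAB, ← finprod_mem_mul_sdiff hsub hfin,
    finprod_mem_pair hAB, finsum_mem_congr rfl fun w hw => by rw [hmem w hw],
    finprod_mem_congr rfl hmem, finsum_mem_eq_finite_toFinset_sum _ hfin',
    finprod_mem_eq_finite_toFinset_prod _ hfin', Finset.sum_const, Finset.prod_const, hcard,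
    nsmul_eq_mul]

end EdgeForm

/-! ### Attaching a pendant path -/

section AttachPath

variable {V : Type*} {G : Hypergraph V} {k p : ℕ} {u : V}

lemma inr_mem_pendantPathEdge {i a : Fin p} {j : Fin (k - 1)} :
    (Sum.inr (a, j) : V ⊕ (Fin p × Fin (k - 1))) ∈ pendantPathEdge k u p i ↔
      (a.val + 1 = i.val ∧ j.val = 0) ∨ a = i := by
  constructor
  · rintro (⟨_, h⟩ | ⟨a', j', h1, h2, h3⟩ | ⟨j', h⟩)
    · cases h
    · cases h3
      exact Or.inl ⟨h1, h2⟩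
    · cases h
      exact Or.inr rfl
  · rintro (⟨h1, h2⟩ | rfl)
    · exact Or.inr (Or.inl ⟨a, j, h1, h2, rfl⟩)
    · exact Or.inr (Or.inr ⟨j, rfl⟩)

lemma inl_mem_pendantPathEdge {i : Fin p} {a : V} :
    (Sum.inl a : V ⊕ (Fin p × Fin (k - 1))) ∈ pendantPathEdge k u p i ↔ i.val = 0 ∧ a = u := by
  constructor
  · rintro (⟨h, h'⟩ | ⟨a', j', h1, h2, h3⟩ | ⟨j', h⟩)
    · cases h'
      exact ⟨h, rfl⟩
    · cases h3
    · cases h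
  · rintro ⟨h, rfl⟩
    exact Or.inl ⟨h, rfl⟩

/-- The vertex at which the `i`-th edge of a pendant path is attached. -/
def pendantPathJoint (k : ℕ) (hk : 2 ≤ k) (u : V) (p : ℕ) (i : Fin p) :
    V ⊕ (Fin p × Fin (k - 1)) :=
  if i.val = 0 then Sum.inl u else Sum.inr (⟨i.val - 1, by omega⟩, ⟨0, by omega⟩)

lemma pendantPathJoint_notMem_range (hk : 2 ≤ k) (i : Fin p) :
    pendantPathJoint k hk u p i ∉ Set.range fun j : Fin (k - 1) => Sum.inr (i, j) := by
  rintro ⟨j, hj⟩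
  unfold pendantPathJoint at hj
  split_ifs at hj with h
  simp only [Sum.inr.injEq, Prod.mk.injEq, Fin.ext_iff] at hj
  omega

lemma pendantPathEdge_eq_insert (hk : 2 ≤ k) (i : Fin p) :
    pendantPathEdge k u p i = insert (pendantPathJoint k hk u p i)
      (Set.range fun j : Fin (k - 1) => Sum.inr (i, j)) := by
  ext x
  rcases x with a | ⟨a, j⟩
  · rw [inl_mem_pendantPathEdge]
    unfold pendantPathJoint
    split_ifs with h <;> simp [h]
  · rw [inr_mem_pendantPathEdge]
    unfold pendantPathJoint
    split_ifs with h
    · simp [h, eq_comm]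
    · simp only [Set.mem_insert_iff, Sum.inr.injEq, Prod.mk.injEq, Set.mem_range, Fin.ext_iff]
      constructor
      · rintro (h1 | h1)
        · left; omega
        · right; exact ⟨j, by omega, rfl⟩
      · rintro (h1 | ⟨j', h1, _⟩)
        · left; omega
        · right; omega

lemma inr_prodMk_injective (i : Fin p) :
    Function.Injective fun j : Fin (k - 1) => (Sum.inr (i, j) : V ⊕ (Fin p × Fin (k - 1))) :=
  fun j j' h => by simpa using h

lemma ncard_pendantPathEdge (hk : 2 ≤ k) (i : Fin p) : (pendantPathEdge k u p i).ncard = k := by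
  rw [pendantPathEdge_eq_insert hk, Set.ncard_insert_of_notMem
    (pendantPathJoint_notMem_range hk i) (Set.finite_range _), ← Set.image_univ,
    Set.ncard_image_of_injective _ (inr_prodMk_injective i), Set.ncard_univ, Nat.card_fin]
  omega

lemma pendantPathEdge_injective (hk : 3 ≤ k) : Function.Injective (pendantPathEdge k u p) := by
  intro i i' h
  -- The vertex `(i, 1)`, available because `k ≥ 3`, belongs to no pendant edge but the `i`-th.
  have h1 : (Sum.inr (i, ⟨1, by omega⟩) : V ⊕ (Fin p × Fin (k - 1))) ∈ pendantPathEdge k u p i' := by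
    rw [← h]
    exact inr_mem_pendantPathEdge.2 (Or.inr rfl)
  simpa using inr_mem_pendantPathEdge.1 h1

lemma pendantPathEdge_ne_image (hk : 2 ≤ k) (i : Fin p) (e : Set V) :
    pendantPathEdge k u p i ≠ Sum.inl '' e := by
  intro h
  have h1 : (Sum.inr (i, ⟨0, by omega⟩) : V ⊕ (Fin p × Fin (k - 1))) ∈ pendantPathEdge k u p i :=
    inr_mem_pendantPathEdge.2 (Or.inr rfl)
  rw [h] at h1
  obtain ⟨a, _, ha⟩ := h1
  cases ha

lemma IsUniform.attachPath (hG : G.IsUniform k) (hk : 2 ≤ k) :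
    (G.attachPath k u p).IsUniform k := by
  rintro _ (⟨e, he, rfl⟩ | ⟨i, rfl⟩)
  · rw [Set.ncard_image_of_injective _ Sum.inl_injective]
    exact hG e he
  · exact ncard_pendantPathEdge hk i

lemma IsConnected.attachPath (hG : G.IsConnected) (hk : 2 ≤ k) (hu : u ∈ G.vertexSet) :
    (G.attachPath k u p).IsConnected := by
  set K := G.attachPath k u p with hK
  have hsymm : ∀ x y, Relation.ReflTransGen K.Adj x y → Relation.ReflTransGen K.Adj y x :=
    fun x y h => by
      have : Std.Symm K.Adj := ⟨fun _ _ h => Adj.symm h⟩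
      exact Std.Symm.symm _ _ h
  have hbase : ∀ x ∈ G.vertexSet, Relation.ReflTransGen K.Adj (Sum.inl x) (Sum.inl u) := by
    intro x hx
    refine Relation.ReflTransGen.lift (p := K.Adj) Sum.inl ?_ _ _ (hG.2 x hx u hu)
    rintro a b ⟨e, he, ha, hb⟩
    exact ⟨Sum.inl '' e, Or.inl ⟨e, he, rfl⟩, ⟨a, ha, rfl⟩, ⟨b, hb, rfl⟩⟩
  have hnew : ∀ (n : ℕ) (hn : n < p) (j : Fin (k - 1)),
      Relation.ReflTransGen K.Adj (Sum.inr (⟨n, hn⟩, j)) (Sum.inl u) := by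
    intro n
    induction n with
    | zero =>
      intro hn j
      exact Relation.ReflTransGen.single ⟨pendantPathEdge k u p ⟨0, hn⟩, Or.inr ⟨_, rfl⟩,
        inr_mem_pendantPathEdge.2 (Or.inr rfl), inl_mem_pendantPathEdge.2 ⟨rfl, rfl⟩⟩
    | succ n ih =>
      intro hn j
      refine Relation.ReflTransGen.head ?_ (ih (by omega) ⟨0, by omega⟩)
      exact ⟨pendantPathEdge k u p ⟨n + 1, hn⟩, Or.inr ⟨_, rfl⟩,
        inr_mem_pendantPathEdge.2 (Or.inr rfl), inr_mem_pendantPathEdge.2 (Or.inl ⟨rfl, rfl⟩)⟩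
  have hall : ∀ x ∈ K.vertexSet, Relation.ReflTransGen K.Adj x (Sum.inl u) := by
    rintro _ (⟨x, rfl | hx, rfl⟩ | ⟨⟨i, j⟩, rfl⟩)
    · exact Relation.ReflTransGen.refl
    · exact hbase x hx
    · exact hnew i.1 i.2 j
  exact ⟨⟨Sum.inl u, Or.inl ⟨u, Or.inl rfl, rfl⟩⟩,
    fun x hx y hy => (hall x hx).trans (hsymm _ _ (hall y hy))⟩

lemma alphaForm_attachPath [Finite V] (hk : 3 ≤ k) (α : ℝ) (x : V ⊕ (Fin p × Fin (k - 1)) → ℝ) :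
    (G.attachPath k u p).alphaForm k α x = G.alphaForm k α (fun a => x (Sum.inl a)) +
      ∑ i : Fin p, edgeForm k α x (pendantPathEdge k u p i) := by
  unfold alphaForm
  have hdisj : Disjoint ((fun e : Set V => (Sum.inl '' e : Set (V ⊕ (Fin p × Fin (k - 1))))) ''
      G.edgeSet) (Set.range (pendantPathEdge k u p)) := by
    rw [Set.disjoint_left]
    rintro _ ⟨e, _, rfl⟩ ⟨i, hi⟩
    exact pendantPathEdge_ne_image (by omega) i e hi
  have hset : (G.attachPath k u p).edgeSet = (fun e : Set V => Sum.inl '' e) '' G.edgeSet ∪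
    Set.range (pendantPathEdge k u p) := rfl
  rw [hset, finsum_mem_union hdisj (Set.toFinite _) (Set.finite_range _),
    finsum_mem_image (Sum.inl_injective.image_injective.injOn),
    finsum_mem_range (pendantPathEdge_injective hk),
    finsum_eq_sum_of_fintype (fun i : Fin p => edgeForm k α x (pendantPathEdge k u p i))]
  congr 1
  exact finsum_mem_congr rfl fun e _ => edgeForm_image Sum.inl_injective k α x e

lemma powSum_attachPath [Finite V] (hu : u ∈ G.vertexSet) (x : V ⊕ (Fin p × Fin (k - 1)) → ℝ) :
    (G.attachPath k u p).powSum k x = G.powSum k (fun a => x (Sum.inl a)) +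
      ∑ i : Fin p, ∑ j : Fin (k - 1), x (Sum.inr (i, j)) ^ k := by
  unfold powSum
  have hdisj : Disjoint (Sum.inl '' insert u G.vertexSet)
      (Set.range (Sum.inr : Fin p × Fin (k - 1) → V ⊕ (Fin p × Fin (k - 1)))) := by
    rw [Set.disjoint_left]
    rintro _ ⟨a, _, rfl⟩ ⟨b, hb⟩
    cases hb
  have hset : (G.attachPath k u p).vertexSet = Sum.inl '' insert u G.vertexSet ∪
    Set.range Sum.inr := rfl
  rw [hset, finsum_mem_union hdisj (Set.toFinite _) (Set.finite_range _),
    finsum_mem_image Sum.inl_injective.injOn, finsum_mem_range Sum.inr_injective,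
    finsum_eq_sum_of_fintype (fun i : Fin p × Fin (k - 1) => x (Sum.inr i) ^ k),
    Fintype.sum_prod_type, Set.insert_eq_of_mem hu]

/-- The form after attaching a pendant path, for a vector which is constant on the vertices of
degree one of each new edge, except at the end of the path. -/
lemma alphaForm_attachPath_of_eq [Finite V] (hk : 3 ≤ k) (α : ℝ)
    {x : V ⊕ (Fin p × Fin (k - 1)) → ℝ} {a y : ℕ → ℝ} (h0 : x (Sum.inl u) = a 0)
    (h : ∀ (i : Fin p) (j : Fin (k - 1)),
      x (Sum.inr (i, j)) = if j.val = 0 then a (i.val + 1) else y i.val) :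
    (G.attachPath k u p).alphaForm k α x =
      G.alphaForm k α (fun b => x (Sum.inl b)) + pathForm k α p a y := by
  rw [alphaForm_attachPath hk]
  unfold pathForm
  rw [← Fin.sum_univ_eq_sum_range (fun t => pathEdgeForm k α (a t) (y t) (a (t + 1)))]
  congr 1
  refine Finset.sum_congr rfl fun i _ => ?_
  have hk2 : 2 ≤ k := by omega
  have hins := pendantPathEdge_eq_insert (u := u) hk2 i
  have hnm := pendantPathJoint_notMem_range (u := u) hk2 i
  have hA : x (pendantPathJoint k hk2 u p i) = a i := by
    unfold pendantPathJoint
    split_ifs with hi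
    · rw [hi, h0]
    · rw [h, if_pos rfl]
      congr 1
      simp only
      omega
  have hB : x (Sum.inr (i, ⟨0, by omega⟩)) = a (i + 1) := by rw [h, if_pos rfl]
  rw [← hA, ← hB]
  refine edgeForm_eq_pathEdgeForm hk2 α (ncard_pendantPathEdge hk2 i) ?_ ?_ ?_ ?_
  · rw [hins]; exact Set.mem_insert _ _
  · rw [hins]; exact Set.mem_insert_of_mem _ ⟨_, rfl⟩
  · intro h'
    exact hnm (h' ▸ ⟨_, rfl⟩)
  · intro w hw hwA hwB
    rw [hins] at hw
    rcases hw with rfl | ⟨j, rfl⟩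
    · exact (hwA rfl).elim
    · dsimp only
      rw [h, if_neg]
      intro hj
      exact hwB (by rw [show j = ⟨0, by omega⟩ from Fin.ext hj])

/-- The extra `a 0 ^ k` compensates for the attachment vertex, which is counted both in `G` and on
the path. -/
lemma powSum_attachPath_of_eq [Finite V] (hk : 3 ≤ k) (hu : u ∈ G.vertexSet)
    {x : V ⊕ (Fin p × Fin (k - 1)) → ℝ} {a y : ℕ → ℝ}
    (h : ∀ (i : Fin p) (j : Fin (k - 1)),
      x (Sum.inr (i, j)) = if j.val = 0 then a (i.val + 1) else y i.val) :
    (G.attachPath k u p).powSum k x + a 0 ^ k =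
      G.powSum k (fun b => x (Sum.inl b)) + pathPowSum k p a y := by
  rw [powSum_attachPath hu]
  unfold pathPowSum
  rw [Finset.sum_range_succ' (fun t => a t ^ k), ← Fin.sum_univ_eq_sum_range (fun t => y t ^ k),
    ← Fin.sum_univ_eq_sum_range (fun t => a (t + 1) ^ k), Finset.mul_sum]
  have : ∀ i : Fin p, ∑ j : Fin (k - 1), x (Sum.inr (i, j)) ^ k =
      a (i.val + 1) ^ k + ((k - 2 : ℕ) : ℝ) * y i.val ^ k := by
    intro i
    obtain ⟨m, rfl⟩ : ∃ m, k = m + 2 := ⟨k - 2, by omega⟩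
    have h1 : ∀ j : Fin (m + 1), x (Sum.inr (i, j)) =
      if j.val = 0 then a (i.val + 1) else y i.val := h i
    change ∑ j : Fin (m + 1), x (Sum.inr (i, j)) ^ (m + 2) = _
    rw [Fin.sum_univ_succ]
    simp [h1]
  rw [Finset.sum_congr rfl fun i _ => this i, Finset.sum_add_distrib]
  ring

lemma mem_edgeSet_attachPath_of_inl_mem {e : Set (V ⊕ (Fin p × Fin (k - 1)))}
    (he : e ∈ (G.attachPath k u p).edgeSet) {a : V} (ha : Sum.inl a ∈ e) (hau : a ≠ u) :
    ∃ f ∈ G.edgeSet, a ∈ f ∧ e = Sum.inl '' f := by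
  rcases he with ⟨f, hf, rfl⟩ | ⟨i, rfl⟩
  · exact ⟨f, hf, Sum.inl_injective.mem_set_image.1 ha, rfl⟩
  · exact (hau (inl_mem_pendantPathEdge.1 ha).2).elim

lemma eq_pendantPathEdge_of_inr_mem {e : Set (V ⊕ (Fin p × Fin (k - 1)))}
    (he : e ∈ (G.attachPath k u p).edgeSet) {i : Fin p} {j : Fin (k - 1)} (hj : j.val ≠ 0)
    (h : Sum.inr (i, j) ∈ e) : e = pendantPathEdge k u p i := by
  rcases he with ⟨f, hf, rfl⟩ | ⟨i', rfl⟩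
  · obtain ⟨a, _, ha⟩ := h
    cases ha
  · rcases inr_mem_pendantPathEdge.1 h with h | rfl
    · exact (hj h.2).elim
    · rfl

/-- A loose path joining old vertices uses no edge of an attached pendant path. -/
lemma IsLoosePath.edge_of_attachPath (hk : 2 ≤ k) {d : ℕ}
    {w : Fin (d + 1) → V ⊕ (Fin p × Fin (k - 1))} {e : Fin d → Set (V ⊕ (Fin p × Fin (k - 1)))}
    (h : (G.attachPath k u p).IsLoosePath d w e) {x y : V} (hx : w 0 = Sum.inl x)
    (hy : w (Fin.last d) = Sum.inl y) (i : Fin d) : ∃ f ∈ G.edgeSet, Sum.inl '' f = e i := by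
  classical
  by_contra hc
  have hpend : ∀ i, (¬ ∃ f ∈ G.edgeSet, Sum.inl '' f = e i) →
      ∃ r, pendantPathEdge k u p r = e i := fun i hi => (h.edge_mem i).resolve_left hi
  set T : Finset (Fin p) := Finset.univ.filter fun r => ∃ i, pendantPathEdge k u p r = e i with hT
  have hTne : T.Nonempty := by
    obtain ⟨r, hr⟩ := hpend i hc
    exact ⟨r, by simp only [hT, Finset.mem_filter, Finset.mem_univ, true_and]; exact ⟨i, hr⟩⟩
  -- The pendant edge farthest from `u` among those used shares none of its new vertices with
  -- another edge of the loose path. Since the path ends at old vertices, both joints on this edge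
  -- would be its single attachment vertex.
  obtain ⟨r, hrT, hrmax⟩ := T.exists_max_image id hTne
  obtain ⟨i, hi⟩ := (Finset.mem_filter.1 hrT).2
  have hmem : ∀ j, j ≠ i → ∀ c, Sum.inr (r, c) ∉ e j := by
    intro j hji c hc
    rcases h.edge_mem j with ⟨f, hf, hfe⟩ | ⟨r', hr'⟩
    · rw [← hfe] at hc
      obtain ⟨a, _, ha⟩ := hc
      cases ha
    · rw [← hr'] at hc
      rcases inr_mem_pendantPathEdge.1 hc with hc | rfl
      · have := hrmax r' (by
          simp only [hT, Finset.mem_filter, Finset.mem_univ, true_and]; exact ⟨j, hr'⟩)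
        have : r'.val ≤ r.val := this
        omega
      · exact hji (h.edge_injective (hr'.symm.trans hi))
  have hjoint : ∀ v, v ∈ e i → (∀ c, v ≠ Sum.inr (r, c)) → v = pendantPathJoint k hk u p r := by
    intro v hv hne
    rw [← hi, pendantPathEdge_eq_insert hk] at hv
    rcases hv with rfl | ⟨c, rfl⟩
    · rfl
    · exact (hne c rfl).elim
  have hleft : w i.castSucc = pendantPathJoint k hk u p r := by
    refine hjoint _ (h.left_mem i) fun c hc => ?_
    by_cases hi0 : i.val = 0
    · have : i.castSucc = 0 := Fin.ext hi0
      rw [this, hx] at hc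
      cases hc
    · refine hmem ⟨i.val - 1, by omega⟩ (fun h' => ?_) c ?_
      · have := congrArg Fin.val h'
        simp only at this
        omega
      · rw [← hc]
        have h1 : i.castSucc = Fin.succ ⟨i.val - 1, by omega⟩ := by
          apply Fin.ext; simp only [Fin.val_castSucc, Fin.val_succ]; omega
        rw [h1]
        exact h.right_mem _
  have hright : w i.succ = pendantPathJoint k hk u p r := by
    refine hjoint _ (h.right_mem i) fun c hc => ?_
    by_cases hid : i.val + 1 = d
    · have : i.succ = Fin.last d := Fin.ext (by simp [hid])
      rw [this, hy] at hc
      cases hc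
    · refine hmem ⟨i.val + 1, by omega⟩ (fun h' => ?_) c ?_
      · have := congrArg Fin.val h'
        simp only at this
        omega
      · rw [← hc]
        have h1 : i.succ = Fin.castSucc ⟨i.val + 1, by omega⟩ := by
          apply Fin.ext; simp only [Fin.val_castSucc, Fin.val_succ]
        rw [h1]
        exact h.left_mem _
  exact h.left_ne_right i (hleft.trans hright.symm)

lemma IsLoosePath.exists_of_attachPath (hk : 2 ≤ k) (hu : u ∈ G.vertexSet) {d : ℕ}
    {w : Fin (d + 1) → V ⊕ (Fin p × Fin (k - 1))} {e : Fin d → Set (V ⊕ (Fin p × Fin (k - 1)))}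
    (h : (G.attachPath k u p).IsLoosePath d w e) {x y : V} (hx : w 0 = Sum.inl x)
    (hy : w (Fin.last d) = Sum.inl y) :
    ∃ (w' : Fin (d + 1) → V) (e' : Fin d → Set V), (w = fun i => Sum.inl (w' i)) ∧
      (e = fun i => Sum.inl '' e' i) ∧ G.IsLoosePath d w' e' := by
  choose e' he' hee' using h.edge_of_attachPath hk hx hy
  have hw : ∀ i, ∃ a, Sum.inl a = w i := by
    intro i
    refine Fin.cases ⟨x, hx.symm⟩ (fun j => ?_) i
    have h1 := h.right_mem j
    rw [← hee'] at h1
    obtain ⟨a, _, ha⟩ := h1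
    exact ⟨a, ha⟩
  choose w' hw' using hw
  have hww : w = fun i => Sum.inl (w' i) := funext fun i => (hw' i).symm
  have hee : e = fun i => Sum.inl '' e' i := funext fun i => (hee' i).symm
  refine ⟨w', e', hww, hee, ?_⟩
  subst hww hee
  refine h.of_image Sum.inl_injective (fun i => ?_) he'
  rcases h.vertex_mem i with ⟨a, ha, hai⟩ | ⟨b, hb⟩
  · rw [← Sum.inl_injective hai]
    rcases ha with rfl | ha
    · exact hu
    · exact ha
  · cases hb

end AttachPath

end Hypergraph

namespace Hypergraph

variable {V : Type*}

/-! ### Loose paths without branches at inner vertices -/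

/-- A loose path of `G` from `v` to `u` such that all edges of `G` at its vertices other than `u`
and `v` belong to it, while some edge of `G` at `v` does not. -/
structure IsUnbranchedPath (G : Hypergraph V) (u v : V) (s : ℕ) (w : Fin (s + 1) → V)
    (e : Fin s → Set V) : Prop where
  isLoosePath : G.IsLoosePath s w e
  first : w 0 = v
  last : w (Fin.last s) = u
  closed : ∀ i, ∀ x ∈ e i, x ≠ v → x ≠ u → ∀ f ∈ G.edgeSet, x ∈ f → ∃ j, f = e j
  exists_edge : ∃ f ∈ G.edgeSet, v ∈ f ∧ ∀ j, f ≠ e j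

lemma HasInternalPath.exists_isUnbranchedPath [Finite V] {G : Hypergraph V} {k : ℕ} (hk : 2 ≤ k)
    {u v : V} (hu : u ∈ G.vertexSet) (hv : v ∈ G.vertexSet) {p q s : ℕ} (hp : 1 ≤ p) (hq : 1 ≤ q)
    (h : (G.attachTwoPaths k u v p q).HasInternalPath
      (Sum.inl (Sum.inl v)) (Sum.inl (Sum.inl u)) s) :
    ∃ (w : Fin (s + 1) → V) (e : Fin s → Set V), G.IsUnbranchedPath u v s w e := by
  obtain ⟨W, E, hI, h0, hl⟩ := h
  obtain ⟨w₁, e₁, rfl, rfl, h₁⟩ := hI.isLoosePath.exists_of_attachPath hk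
    (Or.inl ⟨v, Or.inr hv, rfl⟩) h0 hl
  obtain ⟨w, e, rfl, rfl, h₂⟩ := h₁.exists_of_attachPath hk hu
    (Sum.inl_injective h0) (Sum.inl_injective hl)
  have hw0 : w 0 = v := Sum.inl_injective (Sum.inl_injective h0)
  have hwl : w (Fin.last s) = u := Sum.inl_injective (Sum.inl_injective hl)
  refine ⟨w, e, h₂, hw0, hwl, fun i x hx hxv hxu f hf hxf => ?_, ?_⟩
  · have hdeg := hI.degree_inner i (Sum.inl (Sum.inl x)) ⟨_, ⟨x, hx, rfl⟩, rfl⟩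
      (fun hc => hxv ((Sum.inl_injective (Sum.inl_injective hc)).trans hw0))
      (fun hc => hxu ((Sum.inl_injective (Sum.inl_injective hc)).trans hwl))
    have hsub : (fun i => (Sum.inl '' (Sum.inl '' e i) :
        Set ((V ⊕ (Fin p × Fin (k - 1))) ⊕ (Fin q × Fin (k - 1))))) ''
        {j | Sum.inl (Sum.inl x) ∈ (Sum.inl '' (Sum.inl '' e j) :
          Set ((V ⊕ (Fin p × Fin (k - 1))) ⊕ (Fin q × Fin (k - 1))))} ⊆
        {f | f ∈ (G.attachTwoPaths k u v p q).edgeSet ∧ Sum.inl (Sum.inl x) ∈ f} := by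
      rintro _ ⟨j, hj, rfl⟩
      exact ⟨hI.isLoosePath.edge_mem j, hj⟩
    -- Equality of the degree in the hypergraph and in the path forces every edge at `x` to be a
    -- path edge.
    have heq := Set.eq_of_subset_of_ncard_le hsub (by
      rw [Set.ncard_image_of_injective _ hI.isLoosePath.edge_injective, ← hdeg]
      rfl) (Set.toFinite _)
    have hmem : (Sum.inl '' (Sum.inl '' f) :
        Set ((V ⊕ (Fin p × Fin (k - 1))) ⊕ (Fin q × Fin (k - 1)))) ∈
        {f | f ∈ (G.attachTwoPaths k u v p q).edgeSet ∧ Sum.inl (Sum.inl x) ∈ f} :=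
      ⟨Or.inl ⟨_, Or.inl ⟨f, hf, rfl⟩, rfl⟩, ⟨_, ⟨x, hxf, rfl⟩, rfl⟩⟩
    rw [← heq] at hmem
    obtain ⟨j, _, hj⟩ := hmem
    exact ⟨j, (Sum.inl_injective.image_injective (Sum.inl_injective.image_injective hj)).symm⟩
  · by_contra! hc
    have hdeg : 3 ≤ (G.attachTwoPaths k u v p q).degree (Sum.inl (Sum.inl (w 0))) :=
      hI.degree_first
    rw [hw0] at hdeg
    have hfirst : ∀ j, v ∈ e j → j.val = 0 := by
      intro j hj
      rw [← hw0] at hj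
      rcases h₂.eq_or_eq_of_mem hj with h | h
      · exact (congrArg Fin.val h).symm
      · exact absurd (congrArg Fin.val h) (by simp)
    set A : Set ((V ⊕ (Fin p × Fin (k - 1))) ⊕ (Fin q × Fin (k - 1))) :=
      pendantPathEdge k (Sum.inl v) q ⟨0, hq⟩ with hA
    -- If all edges of `G` at `v` were on the path, `v` would have degree at most `2`. Besides the
    -- first edge of its own pendant path there would only be the first edge of the internal path
    -- or, when `s = 0` and so `u = v`, that of the other pendant path.
    have hle : ∃ B : Set ((V ⊕ (Fin p × Fin (k - 1))) ⊕ (Fin q × Fin (k - 1))),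
        {f | f ∈ (G.attachTwoPaths k u v p q).edgeSet ∧ Sum.inl (Sum.inl v) ∈ f} ⊆ {A, B} := by
      refine ⟨if hs : 0 < s then Sum.inl '' (Sum.inl '' e ⟨0, hs⟩) else
        Sum.inl '' pendantPathEdge k u p ⟨0, hp⟩, ?_⟩
      rintro f ⟨⟨g, ⟨f, hf, rfl⟩ | ⟨r, rfl⟩, rfl⟩ | ⟨r, rfl⟩, hvf⟩
      · right
        have hvf' : v ∈ f := Sum.inl_injective.mem_set_image.1 (Sum.inl_injective.mem_set_image.1 hvf)
        obtain ⟨j, rfl⟩ := hc f hf hvf'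
        have hj := hfirst j hvf'
        have hs : 0 < s := by have := j.2; omega
        rw [dif_pos hs, Set.mem_singleton_iff, show j = ⟨0, hs⟩ from Fin.ext hj]
      · right
        have hr := inl_mem_pendantPathEdge.1 (Sum.inl_injective.mem_set_image.1 hvf)
        have hs : ¬ 0 < s := by
          intro hs
          have h3 : (0 : Fin (s + 1)) = Fin.last s :=
            h₂.vertex_injective (hw0.trans (hr.2.trans hwl.symm))
          have := congrArg Fin.val h3
          simp at this
          omega
        rw [dif_neg hs, Set.mem_singleton_iff, show r = ⟨0, hp⟩ from Fin.ext hr.1]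
      · left
        have hr := inl_mem_pendantPathEdge.1 hvf
        rw [show r = ⟨0, hq⟩ from Fin.ext hr.1]
    obtain ⟨B, hB⟩ := hle
    have h1 := (Set.ncard_le_ncard hB (Set.toFinite _)).trans ((Set.ncard_insert_le A {B}).trans_eq
      (by rw [Set.ncard_singleton]))
    have h2 : (3 : ℕ) ≤ {f | f ∈ (G.attachTwoPaths k u v p q).edgeSet ∧
      Sum.inl (Sum.inl v) ∈ f}.ncard := hdeg
    omega

/-! ### The form of the core -/

/-- The form of the edges of `G` outside a loose path, with the values `a` at `v` and `b` at `u`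
and the values of `r` elsewhere. -/
noncomputable def corePart (G : Hypergraph V) (k : ℕ) (α : ℝ) (u v : V) {s : ℕ}
    (e : Fin s → Set V) (r : V → ℝ) (a b : ℝ) : ℝ :=
  open Classical in
  ∑ᶠ f ∈ G.edgeSet \ Set.range e, edgeForm k α (Function.update (Function.update r u b) v a) f

/-- The sum of the `k`-th powers of the values of `r` outside a loose path. -/
noncomputable def corePowSum (G : Hypergraph V) (k : ℕ) {s : ℕ} (w : Fin (s + 1) → V)
    (e : Fin s → Set V) (r : V → ℝ) : ℝ :=
  ∑ᶠ a ∈ G.vertexSet \ (Set.range w ∪ ⋃ j, e j), r a ^ k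

lemma differentiable_corePart [Finite V] (G : Hypergraph V) (k : ℕ) (α : ℝ) (u v : V) {s : ℕ}
    (e : Fin s → Set V) (r : V → ℝ) :
    Differentiable ℝ fun x : ℝ × ℝ => G.corePart k α u v e r x.1 x.2 := by
  classical
  have hupd : ∀ a, Differentiable ℝ fun x : ℝ × ℝ =>
      Function.update (Function.update r u x.2) v x.1 a := by
    intro a
    by_cases hav : a = v
    · subst hav
      simp only [Function.update_self]
      fun_prop
    · by_cases hau : a = u
      · subst hau
        simp only [Function.update_of_ne hav, Function.update_self]
        fun_prop
      · simp only [Function.update_of_ne hav, Function.update_of_ne hau]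
        fun_prop
  have hform : ∀ f : Set V, Differentiable ℝ fun x : ℝ × ℝ =>
      edgeForm k α (Function.update (Function.update r u x.2) v x.1) f := by
    intro f
    have hf : f.Finite := Set.toFinite f
    simp only [edgeForm, finsum_mem_eq_finite_toFinset_sum _ hf,
      finprod_mem_eq_finite_toFinset_prod _ hf]
    have hprod : Differentiable ℝ fun x : ℝ × ℝ =>
        ∏ a ∈ hf.toFinset, Function.update (Function.update r u x.2) v x.1 a := fun x =>
      (HasFDerivAt.finsetProd fun a _ => (hupd a x).hasFDerivAt).differentiableAt
    fun_prop
  have hE : (G.edgeSet \ Set.range e).Finite := Set.toFinite _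
  have : (fun x : ℝ × ℝ => G.corePart k α u v e r x.1 x.2) = fun x : ℝ × ℝ =>
      ∑ f ∈ hE.toFinset,
        edgeForm k α (Function.update (Function.update r u x.2) v x.1) f := by
    ext x
    unfold corePart
    rw [← finsum_mem_eq_finite_toFinset_sum _ hE]
  rw [this]
  fun_prop

lemma edgeForm_le_edgeForm {k : ℕ} {α : ℝ} (hα0 : 0 ≤ α) (hα1 : α < 1) {e : Set V}
    (he : e.Finite) {x y : V → ℝ} (hx : ∀ a ∈ e, 0 ≤ x a) (hxy : ∀ a ∈ e, x a ≤ y a) :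
    edgeForm k α x e ≤ edgeForm k α y e := by
  unfold edgeForm
  rw [finsum_mem_eq_finite_toFinset_sum _ he, finsum_mem_eq_finite_toFinset_sum _ he,
    finprod_mem_eq_finite_toFinset_prod _ he, finprod_mem_eq_finite_toFinset_prod _ he]
  refine add_le_add (mul_le_mul_of_nonneg_left (Finset.sum_le_sum fun a ha => ?_) hα0)
    (mul_le_mul_of_nonneg_left (Finset.prod_le_prod (fun a ha => ?_) fun a ha => ?_)
      (mul_nonneg (by linarith) (Nat.cast_nonneg k)))
  · exact pow_le_pow_left₀ (hx a (he.mem_toFinset.1 ha)) (hxy a (he.mem_toFinset.1 ha)) k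
  · exact hx a (he.mem_toFinset.1 ha)
  · exact hxy a (he.mem_toFinset.1 ha)

/-- Strictness is drawn from the product, whose coefficient is positive; the power term disappears
for `α = 0`. -/
lemma edgeForm_lt_edgeForm {k : ℕ} (hk : 1 ≤ k) {α : ℝ} (hα0 : 0 ≤ α) (hα1 : α < 1) {e : Set V}
    (he : e.Finite) {x y : V → ℝ} (hx : ∀ a ∈ e, 0 < x a) (hxy : ∀ a ∈ e, x a ≤ y a)
    (hlt : ∃ a ∈ e, x a < y a) : edgeForm k α x e < edgeForm k α y e := by
  unfold edgeForm
  rw [finsum_mem_eq_finite_toFinset_sum _ he, finsum_mem_eq_finite_toFinset_sum _ he,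
    finprod_mem_eq_finite_toFinset_prod _ he, finprod_mem_eq_finite_toFinset_prod _ he]
  obtain ⟨b, hb, hblt⟩ := hlt
  have hk' : (0 : ℝ) < k := by exact_mod_cast hk
  refine add_lt_add_of_le_of_lt
    (mul_le_mul_of_nonneg_left (Finset.sum_le_sum fun a ha => ?_) hα0)
    (mul_lt_mul_of_pos_left (Finset.prod_lt_prod (fun a ha => ?_) (fun a ha => ?_)
      ⟨b, he.mem_toFinset.2 hb, hblt⟩) (mul_pos (by linarith) hk'))
  · exact pow_le_pow_left₀ (hx a (he.mem_toFinset.1 ha)).le (hxy a (he.mem_toFinset.1 ha)) k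
  · exact hx a (he.mem_toFinset.1 ha)
  · exact hxy a (he.mem_toFinset.1 ha)

/-- Strictness in the value at `v` uses the edge at `v` outside the path. For `u = v` the outer
update wins and only the first argument counts, so the statement covers `s = 0` as well. -/
lemma corePart_lt_corePart [Finite V] {G : Hypergraph V} {k : ℕ} (hk : 1 ≤ k) {α : ℝ}
    (hα0 : 0 ≤ α) (hα1 : α < 1) {u v : V} {s : ℕ} {w : Fin (s + 1) → V} {e : Fin s → Set V}
    (h : G.IsUnbranchedPath u v s w e) {r : V → ℝ} (hr : ∀ x, 0 < r x) {a a' b b' : ℝ}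
    (ha : 0 < a) (haa' : a < a') (hb : 0 < b) (hbb' : b ≤ b') :
    G.corePart k α u v e r a b < G.corePart k α u v e r a' b' := by
  classical
  obtain ⟨f₀, hf₀, hvf₀, hf₀e⟩ := h.exists_edge
  have hpos : ∀ x, 0 < Function.update (Function.update r u b) v a x := by
    intro x
    simp only [Function.update_apply]
    split_ifs <;> first | assumption | exact hr x
  have hle : ∀ x, Function.update (Function.update r u b) v a x ≤
      Function.update (Function.update r u b') v a' x := by
    intro x
    simp only [Function.update_apply]
    split_ifs
    · exact haa'.le
    · exact hbb'
    · exact le_rfl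
  have hE : (G.edgeSet \ Set.range e).Finite := Set.toFinite _
  have hcore : ∀ a b, G.corePart k α u v e r a b = ∑ f ∈ hE.toFinset,
      edgeForm k α (Function.update (Function.update r u b) v a) f := by
    intro a b
    rw [← finsum_mem_eq_finite_toFinset_sum _ hE]
    unfold corePart
    congr!
  rw [hcore, hcore]
  refine Finset.sum_lt_sum (fun f _ => edgeForm_le_edgeForm hα0 hα1 (Set.toFinite _)
    (fun x _ => (hpos x).le) fun x _ => hle x) ⟨f₀, ?_, ?_⟩
  · rw [hE.mem_toFinset]
    exact ⟨hf₀, fun ⟨j, hj⟩ => hf₀e j hj.symm⟩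
  · exact edgeForm_lt_edgeForm hk hα0 hα1 (Set.toFinite _) (fun x _ => hpos x)
      (fun x _ => hle x) ⟨v, hvf₀, by simpa using haa'⟩

/-! ### Vectors which are constant on the inner vertices of the edges of a path -/

section Path

variable {G : Hypergraph V} {u v : V} {s : ℕ} {w : Fin (s + 1) → V} {e : Fin s → Set V}

/-- By `closed`, an edge off the path meets it at most in `u` and `v`, so its contribution depends
on the path values only through `z 0` and `z s`. -/
lemma IsUnbranchedPath.alphaForm_eq [Finite V] (h : G.IsUnbranchedPath u v s w e) {k : ℕ}
    (hk : 2 ≤ k) (hG : G.IsUniform k) (α : ℝ) {x r : V → ℝ} {z η : ℕ → ℝ}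
    (hw : ∀ i, x (w i) = z i)
    (he : ∀ j, ∀ a ∈ e j, a ≠ w j.castSucc → a ≠ w j.succ → x a = η j)
    (hr : ∀ a, (∀ i, a ≠ w i) → (∀ j, a ∉ e j) → x a = r a) :
    G.alphaForm k α x = pathForm k α s z η + G.corePart k α u v e r (z 0) (z s) := by
  classical
  have hP := h.isLoosePath
  have hsub : Set.range e ⊆ G.edgeSet := by
    rintro _ ⟨j, rfl⟩
    exact hP.edge_mem j
  unfold alphaForm
  rw [← finsum_mem_add_sdiff hsub (Set.toFinite _), finsum_mem_range hP.edge_injective,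
    finsum_eq_sum_of_fintype]
  congr 1
  · unfold pathForm
    rw [← Fin.sum_univ_eq_sum_range (fun t => pathEdgeForm k α (z t) (η t) (z (t + 1)))]
    refine Finset.sum_congr rfl fun j _ => ?_
    rw [edgeForm_eq_pathEdgeForm hk α (hG _ (hP.edge_mem j)) (hP.left_mem j) (hP.right_mem j)
      (hP.left_ne_right j) (he j), hw, hw]
    rfl
  · unfold corePart
    refine finsum_mem_congr rfl fun f hf => edgeForm_congr fun a ha => ?_
    have hv : x v = z 0 := by rw [← h.first, hw]; rfl
    have hu : x u = z s := by rw [← h.last, hw]; rfl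
    by_cases hav : a = v
    · subst hav
      simp [hv]
    by_cases hau : a = u
    · subst hau
      simp [hav, hu]
    rw [Function.update_of_ne hav, Function.update_of_ne hau]
    have hne : ∀ j, a ∉ e j := by
      intro j haj
      obtain ⟨i, hi⟩ := h.closed j a haj hav hau f hf.1 ha
      exact hf.2 ⟨i, hi.symm⟩
    refine hr a (fun i => ?_) hne
    rintro rfl
    refine Fin.cases (fun hav _ => hav h.first) (fun j _ hne => ?_) i hav hne
    exact hne j (hP.right_mem j)

lemma IsUnbranchedPath.powSum_eq [Finite V] (h : G.IsUnbranchedPath u v s w e) {k : ℕ}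
    (hG : G.IsUniform k) {x r : V → ℝ} {z η : ℕ → ℝ}
    (hw : ∀ i, x (w i) = z i)
    (he : ∀ j, ∀ a ∈ e j, a ≠ w j.castSucc → a ≠ w j.succ → x a = η j)
    (hr : ∀ a, (∀ i, a ≠ w i) → (∀ j, a ∉ e j) → x a = r a) :
    G.powSum k x = pathPowSum k s z η + G.corePowSum k w e r := by
  have hP := h.isLoosePath
  set M : Fin s → Set V := fun j => e j \ {w j.castSucc, w j.succ} with hM
  have hMne : ∀ j, ∀ a ∈ M j, ∀ i, a ≠ w i := by
    rintro j a ⟨ha, ha'⟩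
    simp only [Set.mem_insert_iff, Set.mem_singleton_iff, not_or] at ha'
    exact hP.ne_of_mem_edge ha ha'.1 ha'.2
  -- Consecutive edges overlap in joints. Removing the joints from the edges gives a disjoint
  -- decomposition, over which the sum splits.
  have hU : Set.range w ∪ ⋃ j, e j = Set.range w ∪ ⋃ j, M j := by
    ext a
    simp only [Set.mem_union, Set.mem_iUnion]
    constructor
    · rintro (ha | ⟨j, ha⟩)
      · exact Or.inl ha
      · by_cases hc : a ∈ ({w j.castSucc, w j.succ} : Set V)
        · rcases hc with rfl | rfl
          · exact Or.inl ⟨_, rfl⟩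
          · exact Or.inl ⟨_, rfl⟩
        · exact Or.inr ⟨j, ha, hc⟩
    · rintro (ha | ⟨j, ha⟩)
      · exact Or.inl ha
      · exact Or.inr ⟨j, ha.1⟩
  have hsub : Set.range w ∪ ⋃ j, e j ⊆ G.vertexSet := by
    rintro a (⟨i, rfl⟩ | ha)
    · exact hP.vertex_mem i
    · obtain ⟨j, hj⟩ := Set.mem_iUnion.1 ha
      exact G.subset_vertexSet_of_mem_edgeSet' (hP.edge_mem j) hj
  have hdisj : Disjoint (Set.range w) (⋃ j, M j) := by
    rw [Set.disjoint_left]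
    rintro _ ⟨i, rfl⟩ ha
    obtain ⟨j, hj⟩ := Set.mem_iUnion.1 ha
    exact hMne j _ hj i rfl
  have hpair : Pairwise (Function.onFun Disjoint M) := by
    intro i j hij
    rw [Function.onFun, Set.disjoint_left]
    intro a hi hj
    exact hij (hP.eq_edge_of_mem hj.1 (hMne j a hj) hi.1)
  unfold powSum corePowSum
  rw [← finsum_mem_add_sdiff hsub (Set.toFinite _)]
  congr 1
  · rw [hU, finsum_mem_union hdisj (Set.toFinite _) (Set.toFinite _),
      finsum_mem_range hP.vertex_injective, finsum_eq_sum_of_fintype,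
      finsum_mem_iUnion hpair fun j => Set.toFinite _, finsum_eq_sum_of_fintype]
    unfold pathPowSum
    rw [← Fin.sum_univ_eq_sum_range (fun t => z t ^ k),
      ← Fin.sum_univ_eq_sum_range (fun t => η t ^ k), Finset.mul_sum]
    congr 1
    · exact Finset.sum_congr rfl fun i _ => by rw [hw]
    · refine Finset.sum_congr rfl fun j _ => ?_
      have hfin : (M j).Finite := Set.toFinite _
      have hval : ∀ a ∈ M j, x a ^ k = η j ^ k := by
        rintro a ⟨ha, ha'⟩
        simp only [Set.mem_insert_iff, Set.mem_singleton_iff, not_or] at ha'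
        rw [he j a ha ha'.1 ha'.2]
      rw [finsum_mem_congr rfl hval, finsum_mem_eq_finite_toFinset_sum _ hfin,
        Finset.sum_const, ← Set.ncard_eq_toFinset_card _ hfin,
        ncard_sdiff_pair (hP.left_mem j) (hP.right_mem j) (hP.left_ne_right j),
        hG _ (hP.edge_mem j), nsmul_eq_mul]
  · refine finsum_mem_congr rfl fun a ha => ?_
    have ha' := ha.2
    simp only [Set.mem_union, Set.mem_range, Set.mem_iUnion, not_or, not_exists] at ha'
    rw [hr a (fun i hi => ha'.1 i hi.symm) ha'.2]

/-! ### The pendant paths and the internal path as one long path -/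

lemma pathForm_add (k : ℕ) (α : ℝ) (a b : ℕ) (z η : ℕ → ℝ) :
    pathForm k α (a + b) z η =
      pathForm k α a z η + pathForm k α b (fun t => z (a + t)) (fun t => η (a + t)) :=
  Finset.sum_range_add _ _ _

/-- The joint `a` is common to both parts, hence the extra term on the left. -/
lemma pathPowSum_add (k a b : ℕ) (z η : ℕ → ℝ) :
    pathPowSum k (a + b) z η + z a ^ k =
      pathPowSum k a z η + pathPowSum k b (fun t => z (a + t)) (fun t => η (a + t)) := by
  unfold pathPowSum
  rw [show a + b + 1 = a + (b + 1) from rfl, Finset.sum_range_add (fun t => z t ^ k),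
    Finset.sum_range_succ (fun t => z t ^ k) a, Finset.sum_range_add (fun t => η t ^ k)]
  ring

/-- The vector `x` on `G_{u,v}(p, q)` has the values `z` at the joints of the path of length
`p + q + s` formed by the two pendant paths and the path `w`, the values `η` at the other vertices
of the edges of this path, and the values of `r` elsewhere. -/
structure IsPathVector {k p q : ℕ} (w : Fin (s + 1) → V) (e : Fin s → Set V)
    (x : (V ⊕ (Fin p × Fin (k - 1))) ⊕ (Fin q × Fin (k - 1)) → ℝ) (z η : ℕ → ℝ) (r : V → ℝ) :
    Prop where
  joint : ∀ i, x (Sum.inl (Sum.inl (w i))) = z (q + i)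
  inner : ∀ j, ∀ a ∈ e j, a ≠ w j.castSucc → a ≠ w j.succ → x (Sum.inl (Sum.inl a)) = η (q + j)
  outer : ∀ a, (∀ i, a ≠ w i) → (∀ j, a ∉ e j) → x (Sum.inl (Sum.inl a)) = r a
  left : ∀ (i : Fin q) (j : Fin (k - 1)),
    x (Sum.inr (i, j)) = if j.val = 0 then z (q - 1 - i) else η (q - 1 - i)
  right : ∀ (i : Fin p) (j : Fin (k - 1)),
    x (Sum.inl (Sum.inr (i, j))) = if j.val = 0 then z (q + s + i + 1) else η (q + s + i)

lemma IsUnbranchedPath.alphaForm_attachTwoPaths [Finite V] (h : G.IsUnbranchedPath u v s w e)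
    {k p q : ℕ} (hk : 3 ≤ k) (hG : G.IsUniform k) (α : ℝ)
    {x : (V ⊕ (Fin p × Fin (k - 1))) ⊕ (Fin q × Fin (k - 1)) → ℝ} {z η : ℕ → ℝ} {r : V → ℝ}
    (hx : IsPathVector w e x z η r) :
    (G.attachTwoPaths k u v p q).alphaForm k α x =
      pathForm k α (p + q + s) z η + G.corePart k α u v e r (z q) (z (q + s)) := by
  have hv : x (Sum.inl (Sum.inl v)) = z q := by rw [← h.first, hx.joint]; rfl
  have hu : x (Sum.inl (Sum.inl u)) = z (q + s) := by rw [← h.last, hx.joint]; rfl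
  unfold attachTwoPaths
  -- The path at `v` is indexed outwards from `v`, against the direction of the long path;
  -- `pathForm_reverse` turns it round.
  rw [alphaForm_attachPath_of_eq hk α (a := fun t => z (q - t)) (y := fun t => η (q - 1 - t)) hv
      (fun i j => by rw [hx.left, show q - (i.val + 1) = q - 1 - i.val by omega]),
    alphaForm_attachPath_of_eq hk α (x := fun b => x (Sum.inl b)) (a := fun t => z (q + s + t))
      (y := fun t => η (q + s + t)) hu (fun i j => hx.right i j),
    h.alphaForm_eq (by omega) hG α (z := fun t => z (q + t)) (η := fun t => η (q + t)) hx.joint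
      hx.inner hx.outer, pathForm_reverse, show p + q + s = q + (s + p) by omega, pathForm_add,
    pathForm_add]
  simp only [add_assoc, add_zero]
  ring

lemma IsUnbranchedPath.powSum_attachTwoPaths [Finite V] (h : G.IsUnbranchedPath u v s w e)
    (hu : u ∈ G.vertexSet) (hv : v ∈ G.vertexSet) {k p q : ℕ} (hk : 3 ≤ k) (hG : G.IsUniform k)
    {x : (V ⊕ (Fin p × Fin (k - 1))) ⊕ (Fin q × Fin (k - 1)) → ℝ} {z η : ℕ → ℝ} {r : V → ℝ}
    (hx : IsPathVector w e x z η r) :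
    (G.attachTwoPaths k u v p q).powSum k x =
      pathPowSum k (p + q + s) z η + G.corePowSum k w e r := by
  unfold attachTwoPaths
  have h1 := powSum_attachPath_of_eq (G := G.attachPath k u p) (u := Sum.inl v) hk
    (Or.inl ⟨v, Or.inr hv, rfl⟩) (x := x) (a := fun t => z (q - t)) (y := fun t => η (q - 1 - t))
    (fun i j => by rw [hx.left, show q - (i.val + 1) = q - 1 - i.val by omega])
  have h2 := powSum_attachPath_of_eq hk hu (a := fun t => z (q + s + t))
    (y := fun t => η (q + s + t)) (x := fun b => x (Sum.inl b)) (fun i j => hx.right i j)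
  have h3 := h.powSum_eq hG (x := fun b => x (Sum.inl (Sum.inl b))) (z := fun t => z (q + t))
    (η := fun t => η (q + t)) hx.joint hx.inner hx.outer
  have h4 := pathPowSum_add k q (s + p) z η
  have h5 := pathPowSum_add k s p (fun t => z (q + t)) (fun t => η (q + t))
  rw [pathPowSum_reverse] at h1
  rw [show p + q + s = q + (s + p) by omega]
  simp only [add_assoc, Nat.sub_zero, add_zero] at *
  linarith

lemma IsUnbranchedPath.exists_isPathVector (h : G.IsUnbranchedPath u v s w e) (k p q : ℕ)
    {z η : ℕ → ℝ} {r : V → ℝ} (hz : ∀ t, 0 < z t) (hη : ∀ t, 0 < η t) (hr : ∀ a, 0 < r a) :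
    ∃ x : (V ⊕ (Fin p × Fin (k - 1))) ⊕ (Fin q × Fin (k - 1)) → ℝ,
      IsPathVector w e x z η r ∧ ∀ i, 0 < x i := by
  classical
  have hP := h.isLoosePath
  set y : V → ℝ := fun a => if hw : ∃ i, a = w i then z (q + (hw.choose : Fin (s + 1))) else
    if he : ∃ j, a ∈ e j then η (q + (he.choose : Fin s)) else r a with hy
  have hypos : ∀ a, 0 < y a := by
    intro a
    simp only [hy]
    split_ifs
    · exact hz _
    · exact hη _
    · exact hr _
  refine ⟨Sum.elim (Sum.elim y fun ij => if ij.2.val = 0 then z (q + s + ij.1 + 1) else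
    η (q + s + ij.1)) fun ij => if ij.2.val = 0 then z (q - 1 - ij.1) else η (q - 1 - ij.1),
    ⟨fun i => ?_, fun j a ha h1 h2 => ?_, fun a h1 h2 => ?_, fun i j => rfl, fun i j => rfl⟩, ?_⟩
  · have hw : ∃ i', w i = w i' := ⟨i, rfl⟩
    have : hw.choose = i := (hP.vertex_injective hw.choose_spec).symm
    simp only [Sum.elim_inl, hy, dif_pos hw, this]
  · have hw : ¬ ∃ i, a = w i := fun ⟨i, hi⟩ => hP.ne_of_mem_edge ha h1 h2 i hi
    have he : ∃ j, a ∈ e j := ⟨j, ha⟩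
    have : he.choose = j := hP.eq_edge_of_mem ha (hP.ne_of_mem_edge ha h1 h2) he.choose_spec
    simp only [Sum.elim_inl, hy, dif_neg hw, dif_pos he, this]
  · have hw : ¬ ∃ i, a = w i := fun ⟨i, hi⟩ => h1 i hi
    have he : ¬ ∃ j, a ∈ e j := fun ⟨j, hj⟩ => h2 j hj
    simp only [Sum.elim_inl, hy, dif_neg hw, dif_neg he]
  · rintro ((a | ⟨i, j⟩) | ⟨i, j⟩)
    · exact hypos a
    · simp only [Sum.elim_inl, Sum.elim_inr]
      split_ifs
      · exact hz _
      · exact hη _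
    · simp only [Sum.elim_inr]
      split_ifs
      · exact hz _
      · exact hη _

/-- A positive vector which takes the same value at any two vertices of an edge that lie in no
other edge is constant on the inner vertices of the edges of the path. -/
lemma IsUnbranchedPath.exists_isPathVector_of_eq (h : G.IsUnbranchedPath u v s w e) {k p q : ℕ}
    (hk : 3 ≤ k) {x : (V ⊕ (Fin p × Fin (k - 1))) ⊕ (Fin q × Fin (k - 1)) → ℝ}
    (hx : ∀ i, 0 < x i)
    (heq : ∀ e ∈ (G.attachTwoPaths k u v p q).edgeSet, ∀ i ∈ e, ∀ j ∈ e,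
      (∀ f ∈ (G.attachTwoPaths k u v p q).edgeSet, i ∈ f → f = e) →
      (∀ f ∈ (G.attachTwoPaths k u v p q).edgeSet, j ∈ f → f = e) → x i = x j) :
    ∃ z η : ℕ → ℝ, (∀ t, 0 < z t) ∧ (∀ t, 0 < η t) ∧
      IsPathVector w e x z η fun a => x (Sum.inl (Sum.inl a)) := by
  have hP := h.isLoosePath
  have hmid : ∀ j : Fin s, ∃ y : ℝ, 0 < y ∧ ∀ a ∈ e j, a ≠ w j.castSucc → a ≠ w j.succ →
      x (Sum.inl (Sum.inl a)) = y := by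
    intro j
    have honly : ∀ a ∈ e j, a ≠ w j.castSucc → a ≠ w j.succ →
        ∀ f ∈ (G.attachTwoPaths k u v p q).edgeSet, Sum.inl (Sum.inl a) ∈ f →
          f = Sum.inl '' (Sum.inl '' e j) := by
      intro a ha h1 h2 f hf haf
      have hne := hP.ne_of_mem_edge ha h1 h2
      have hav : a ≠ v := h.first ▸ hne 0
      have hau : a ≠ u := h.last ▸ hne (Fin.last s)
      obtain ⟨g, hg, hag, rfl⟩ := mem_edgeSet_attachPath_of_inl_mem hf haf
        (fun hc => hav (Sum.inl_injective hc))
      obtain ⟨f', hf', haf', rfl⟩ := mem_edgeSet_attachPath_of_inl_mem hg hag hau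
      obtain ⟨i, rfl⟩ := h.closed j a ha hav hau f' hf' haf'
      rw [hP.eq_edge_of_mem ha hne haf']
    by_cases hc : ∃ a ∈ e j, a ≠ w j.castSucc ∧ a ≠ w j.succ
    · obtain ⟨b, hb, hb1, hb2⟩ := hc
      refine ⟨x (Sum.inl (Sum.inl b)), hx _, fun a ha h1 h2 => ?_⟩
      exact heq _ (Or.inl ⟨_, Or.inl ⟨_, hP.edge_mem j, rfl⟩, rfl⟩) _ ⟨_, ⟨a, ha, rfl⟩, rfl⟩ _
        ⟨_, ⟨b, hb, rfl⟩, rfl⟩ (honly a ha h1 h2) (honly b hb hb1 hb2)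
    · push Not at hc
      -- With no vertex besides the two joints there is no condition on the value, and `1` is an
      -- arbitrary positive choice.
      exact ⟨1, one_pos, fun a ha h1 h2 => absurd (hc a ha h1) h2⟩
  choose y hy hye using hmid
  have hleft : ∀ (i : Fin q) (j : Fin (k - 1)), j.val ≠ 0 →
      x (Sum.inr (i, j)) = x (Sum.inr (i, ⟨1, by omega⟩)) := by
    intro i j hj
    exact heq (pendantPathEdge k (Sum.inl v) q i) (Or.inr ⟨i, rfl⟩) _
      (inr_mem_pendantPathEdge.2 (Or.inr rfl)) _ (inr_mem_pendantPathEdge.2 (Or.inr rfl))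
      (fun f hf hif => eq_pendantPathEdge_of_inr_mem hf hj hif)
      (fun f hf hif => eq_pendantPathEdge_of_inr_mem hf one_ne_zero hif)
  have hright : ∀ (i : Fin p) (j : Fin (k - 1)), j.val ≠ 0 →
      x (Sum.inl (Sum.inr (i, j))) = x (Sum.inl (Sum.inr (i, ⟨1, by omega⟩))) := by
    intro i j hj
    have honly : ∀ j : Fin (k - 1), j.val ≠ 0 →
        ∀ f ∈ (G.attachTwoPaths k u v p q).edgeSet, Sum.inl (Sum.inr (i, j)) ∈ f →
          f = Sum.inl '' pendantPathEdge k u p i := by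
      intro j hj f hf hif
      obtain ⟨g, hg, hag, rfl⟩ := mem_edgeSet_attachPath_of_inl_mem hf hif (by simp)
      rw [eq_pendantPathEdge_of_inr_mem hg hj hag]
    exact heq (Sum.inl '' pendantPathEdge k u p i) (Or.inl ⟨_, Or.inr ⟨i, rfl⟩, rfl⟩) _
      ⟨_, inr_mem_pendantPathEdge.2 (Or.inr rfl), rfl⟩ _
      ⟨_, inr_mem_pendantPathEdge.2 (Or.inr rfl), rfl⟩ (honly j hj) (honly _ one_ne_zero)
  -- The values are read off along the long path: the path at `v` backwards, then `w`, then the path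
  -- at `u`. Index `0` of a pendant edge is its outer joint and index `1` represents its other new
  -- vertices. Beyond the path, `1` keeps the sequences positive.
  refine ⟨fun t => if h1 : t < q then x (Sum.inr (⟨q - 1 - t, by omega⟩, ⟨0, by omega⟩)) else
      if h2 : t - q < s + 1 then x (Sum.inl (Sum.inl (w ⟨t - q, h2⟩))) else
      if h3 : t - (q + s + 1) < p then x (Sum.inl (Sum.inr (⟨t - (q + s + 1), h3⟩, ⟨0, by omega⟩)))
      else 1,
    fun t => if h1 : t < q then x (Sum.inr (⟨q - 1 - t, by omega⟩, ⟨1, by omega⟩)) else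
      if h2 : t - q < s then y ⟨t - q, h2⟩ else
      if h3 : t - (q + s) < p then x (Sum.inl (Sum.inr (⟨t - (q + s), h3⟩, ⟨1, by omega⟩)))
      else 1, fun t => ?_, fun t => ?_, fun i => ?_, fun j a ha h1 h2 => ?_, fun a _ _ => rfl,
      fun i j => ?_, fun i j => ?_⟩
  · dsimp only
    split_ifs <;> first | exact hx _ | exact one_pos
  · dsimp only
    split_ifs <;> first | exact hx _ | exact hy _ | exact one_pos
  · rw [dif_neg (by omega), dif_pos (by omega)]
    congr 4
    exact Fin.ext (by simp)
  · rw [dif_neg (by omega), dif_pos (by omega), hye j a ha h1 h2]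
    congr 1
    exact Fin.ext (by simp)
  · have hi : q - 1 - (q - 1 - i.val) = i.val := by omega
    split_ifs with hj h1 h1 <;> first | omega | skip
    · congr 3
      · exact Fin.ext hi.symm
      · exact Fin.ext hj
    · rw [hleft i j hj]
      congr 3
      exact Fin.ext hi.symm
  · by_cases hj : j.val = 0
    · rw [if_pos hj, dif_neg (by omega), dif_neg (by omega), dif_pos (by omega)]
      congr 4
      · exact Fin.ext (by simp only; omega)
      · exact Fin.ext hj
    · rw [if_neg hj, dif_neg (by omega), dif_neg (by omega), dif_pos (by omega), hright i j hj]
      congr 4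
      exact Fin.ext (by simp)

end Path

lemma IsUniform.attachTwoPaths {G : Hypergraph V} {k : ℕ} (hG : G.IsUniform k) (hk : 2 ≤ k)
    (u v : V) (p q : ℕ) : (G.attachTwoPaths k u v p q).IsUniform k :=
  (hG.attachPath hk).attachPath hk

lemma IsConnected.attachTwoPaths {G : Hypergraph V} {k : ℕ} (hG : G.IsConnected) (hk : 2 ≤ k)
    {u v : V} (hu : u ∈ G.vertexSet) (hv : v ∈ G.vertexSet) (p q : ℕ) :
    (G.attachTwoPaths k u v p q).IsConnected :=
  (hG.attachPath hk hu).attachPath hk (Or.inl ⟨v, Or.inr hv, rfl⟩)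

end Hypergraph

theorem mainTheorem1 {V : Type*} [Fintype V] (k : ℕ) (hk : 3 ≤ k)
    (α : ℝ) (hα0 : 0 ≤ α) (hα1 : α < 1)
    (G : Hypergraph V) (hunif : G.IsUniform k) (hconn : G.IsConnected)
    (u v : V) (hu : u ∈ G.vertexSet) (hv : v ∈ G.vertexSet)
    (hu' : ¬ G.IsPendantVertex u) (hv' : ¬ G.IsPendantVertex v)
    (p q s : ℕ) (hq : 1 ≤ q) (hqp : q ≤ p)
    (hpath : (G.attachTwoPaths k u v p q).HasInternalPath
      (Sum.inl (Sum.inl v)) (Sum.inl (Sum.inl u)) s)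
    (hs : s ≤ p - q + 1) :
    (G.attachTwoPaths k u v (p + 1) (q - 1)).alphaSpectralRadius k α <
      (G.attachTwoPaths k u v p q).alphaSpectralRadius k α := by
  -- The path is a path of `G` itself, so it can be used in both hypergraphs.
  obtain ⟨w, e, h⟩ := hpath.exists_isUnbranchedPath (by omega) hu hv (by omega) hq
  have hk2 : 2 ≤ k := by omega
  obtain ⟨hle₁, x, hx, hxeq, heig⟩ := Hypergraph.exists_perron_vector (by omega) hα0 hα1
    (hunif.attachTwoPaths hk2 u v (p + 1) (q - 1)) (hconn.attachTwoPaths hk2 hu hv (p + 1) (q - 1))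
  obtain ⟨hle₂, -⟩ := Hypergraph.exists_perron_vector (by omega) hα0 hα1
    (hunif.attachTwoPaths hk2 u v p q) (hconn.attachTwoPaths hk2 hu hv p q)
  have hL : p + 1 + (q - 1) + s = p + q + s := by omega
  obtain ⟨z, η, hz, hη, hxz⟩ := h.exists_isPathVector_of_eq hk hx (by
    intro f hf i hi j hj hi1 hj1
    have h1 := heig f hf i hi hi1
    have h2 := heig f hf j hj hj1
    set ρ := (G.attachTwoPaths k u v (p + 1) (q - 1)).alphaSpectralRadius k α
    have h3 : 0 < (1 - α) * ∏ᶠ a ∈ f, x a := by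
      rw [finprod_mem_eq_finite_toFinset_prod _ (Set.toFinite f)]
      exact mul_pos (by linarith) (Finset.prod_pos fun a _ => hx a)
    -- Both sides equal `(1 - α)` times the product over the edge. This is positive, so `ρ ≠ α` and
    -- the factor can be cancelled.
    have h4 : (ρ - α) * x i ^ k = (ρ - α) * x j ^ k := by linarith
    have h5 : ρ - α ≠ 0 := by
      intro h0
      have : ρ = α := by linarith
      rw [this] at h1
      linarith
    exact (pow_left_inj₀ (hx i).le (hx j).le (by omega)).1 (mul_left_cancel₀ h5 h4))
  -- All trial vectors keep the Perron values on the core away from `u` and `v`, so only the values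
  -- along the long path vary.
  set r : V → ℝ := fun a => x (Sum.inl (Sum.inl a)) with hr
  have hrpos : ∀ a, 0 < r a := fun a => hx _
  have hR : 0 ≤ G.corePowSum k w e r := by
    unfold Hypergraph.corePowSum
    rw [finsum_mem_eq_finite_toFinset_sum _ (Set.toFinite _)]
    exact Finset.sum_nonneg fun a _ => (pow_pos (hrpos a) k).le
  refine Hypergraph.lt_of_pathForm_le hα0 hα1 hk hq hqp hs hR (Hypergraph.differentiable_corePart G k α u v e r)
    (fun a a' b b' ha haa' hb hbb' =>
      Hypergraph.corePart_lt_corePart (by omega) hα0 hα1 h hrpos ha haa' hb hbb')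
    (fun z η hz hη => ?_) hz hη ?_ (fun z η hz hη => ?_)
  · obtain ⟨y, hy, hypos⟩ := h.exists_isPathVector k (p + 1) (q - 1) hz hη hrpos
    have := hle₁ y fun i => (hypos i).le
    rwa [h.alphaForm_attachTwoPaths hk hunif α hy, h.powSum_attachTwoPaths hu hv hk hunif hy,
      hL] at this
  · rwa [h.alphaForm_attachTwoPaths hk hunif α hxz, h.powSum_attachTwoPaths hu hv hk hunif hxz,
      hL] at hxeq
  · obtain ⟨y, hy, hypos⟩ := h.exists_isPathVector k p q hz hη hrpos
    have := hle₂ y fun i => (hypos i).le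
    rwa [h.alphaForm_attachTwoPaths hk hunif α hy,
      h.powSum_attachTwoPaths hu hv hk hunif hy] at this
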